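/- Let $X$ be a locally compact Hausdorff space with countable base. A boundary kernel for an open set $U\subset X$ is a kernel $T$ on $X$ (with its Borel $\sigma$-algebra $\mathcal B$) such that $T(x,X\setminus\partial U)=0$ for $x\in U$ and $T(x,\cdot)=\varepsilon_x$ (Dirac measure at $x$) for $x\in X\setminus U$; write $Tf(x)=\int f(y)\,T(x,dy)$. Let $\mathcal V$ be a base for the topology of $X$ consisting of relatively compact open sets, and for every $V\in\mathcal V$ let $H_V$ be a boundary kernel for $V$. For open $U$ let $\mathcal V(U):=\{V\in\mathcal V:\overline V\subset U\}$. A local choice in $U$ is a map $\mathcal W$ assigning to each $x\in U$ a fundamental system $\mathcal W(x)\subset\mathcal V(U)$ of neighborhoods of $x$. A lower semicontinuous function $u:U\to\,]-\infty,\infty]$ is $\mathcal W$-hyperharmonic on $U$ if $H_Wu(x)\le u(x)$ for all $x\in U$ and $W\in\mathcal W(x)$; it is hyperharmonic on $U$ if this holds for all $x\in U$ and all $W\in\mathcal V(U)$ with $x\in W$. A continuous function $h:U\to\mathbb R$ is harmonic on $U$ if $H_Vh=h$ on $V$ for all $V\in\mathcal V(U)$. (Throughout, "positive" means $\ge 0$.)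 Suppose that $(H_V)_{V\in\mathcal V}$ is a normal Bauer family of harmonic boundary kernels, that is, for every $V\in\mathcal V$: 1. $H_WH_V=H_V$ for all $W\in\mathcal V$ with $W\subset V$; 2. $H_V1=1$, and $H_Vf$ is continuous on $X$ for every continuous $f:X\to\mathbb R$; 3. there is a local choice $\mathcal W$ in $V$ such that the positive $\mathcal W$-hyperharmonic functions on $V$ separate the points of $V$; 4. $H_Vf$ is continuous on $V$ for every bounded Borel function $f$ on $X$. Suppose further that $(H_V)_{V\in\mathcal V}$ is elliptic: every positive harmonic function on a connected open set is identically zero or strictly positive there. Let $W\subset X$ be a $\mathcal P$-set, that is, an open set such that the positive hyperharmonic functions on $W$ separate the points of $W$. Call a relatively compact open set $U\subset X$ regular if every continuous $f:\partial U\to\mathbb R$ has a unique continuous extension to $\overline U$ which is harmonic on $U$, and this extension is positive whenever $f$ is positive. Then, for every compact $K\subset W$, there exists a regular neighborhood of $K$ in $W$, that is, a regular set $U$ with $K\subset U$ and $\overline U\subset W$. -/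

import Mathlib

open MeasureTheory ProbabilityTheory Topology Set

noncomputable section

namespace Bauer

/-- The integral of an extended real function, as integral of the positive part minus integral of
the negative part. It is only applied where the negative part has a finite integral. -/
def eintegral {X : Type*} [MeasurableSpace X] (μ : Measure X) (u : X → EReal) : EReal :=
  ((∫⁻ y, (u y).toENNReal ∂μ : ENNReal) : EReal) -
    ((∫⁻ y, (-u y).toENNReal ∂μ : ENNReal) : EReal)

variable {X : Type*} [TopologicalSpace X] [MeasurableSpace X]

/-- `T` is a boundary kernel for `U`: for `x ∈ U` the measure `T(x, ·)` does not charge the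
complement of `∂U`, and `T(x, ·)` is the Dirac measure at `x` for `x ∉ U`. -/
def IsBoundaryKernel (U : Set X) (T : Kernel X X) : Prop :=
  (∀ x ∈ U, T x (frontier U)ᶜ = 0) ∧ ∀ x ∉ U, T x = Measure.dirac x

/-- `𝒱(U)`: the members of `𝒱` with closure contained in `U`. -/
def inside (𝒱 : Set (Set X)) (U : Set X) : Set (Set X) :=
  {W | W ∈ 𝒱 ∧ closure W ⊆ U}

/-- `𝒲` is a local choice from `𝒱` in `U`: for `x ∈ U`, `𝒲 x` is a fundamental system of
neighborhoods of `x` consisting of sets in `𝒱(U)`. -/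
def IsLocalChoice (𝒱 : Set (Set X)) (U : Set X) (𝒲 : X → Set (Set X)) : Prop :=
  ∀ x ∈ U, 𝒲 x ⊆ inside 𝒱 U ∧ (𝓝 x).HasBasis (fun W : Set X => W ∈ 𝒲 x) id

/-- `𝒲`-hyperharmonic functions on `U`: lower semicontinuous functions `u` on `U` with values in
`]-∞, ∞]` such that `H_W u (x) ≤ u x` for all `x ∈ U` and `W ∈ 𝒲 x`. Functions on `U` are
represented by functions on `X`, whose values outside `U` play no role
(if `x ∈ W` and `closure W ⊆ U`, then `H_W(x, ·)` is carried by `∂W ⊆ U`). -/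
def HyperharmonicFor (H : Set X → Kernel X X) (𝒲 : X → Set (Set X)) (U : Set X)
    (u : X → EReal) : Prop :=
  (∀ x ∈ U, u x ≠ ⊥) ∧ LowerSemicontinuousOn u U ∧
    ∀ x ∈ U, ∀ W ∈ 𝒲 x, eintegral (H W x) u ≤ u x

/-- The hyperharmonic functions on `U`: here one takes all `W ∈ 𝒱(U)` containing the point. -/
def Hyperharmonic (𝒱 : Set (Set X)) (H : Set X → Kernel X X) (U : Set X) (u : X → EReal) : Prop :=
  HyperharmonicFor H (fun x => {W | W ∈ inside 𝒱 U ∧ x ∈ W}) U u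

/-- The harmonic functions on `U`: continuous real functions `h` on `U` such that `H_V h = h` on `V`
for all `V ∈ 𝒱(U)` (off `V` the equality is automatic, `H_V(x, ·)` being the Dirac measure). -/
def Harmonic (𝒱 : Set (Set X)) (H : Set X → Kernel X X) (U : Set X) (h : X → ℝ) : Prop :=
  ContinuousOn h U ∧ ∀ V ∈ inside 𝒱 U, ∀ x ∈ V, ∫ y, h y ∂(H V x) = h x

/-- A normal Bauer family `(H_V)`, `V ∈ 𝒱`, of harmonic boundary kernels on `X`.
Only the values `H V` with `V ∈ 𝒱` are relevant. -/
structure IsNormalBauerFamily (𝒱 : Set (Set X)) (H : Set X → Kernel X X) : Prop where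
  basis : TopologicalSpace.IsTopologicalBasis 𝒱
  compact_closure : ∀ V ∈ 𝒱, IsCompact (closure V)
  boundary : ∀ V ∈ 𝒱, IsBoundaryKernel V (H V)
  /-- `H_W H_V = H_V`, where `(H_W H_V)(x, ·) = ∫ H_V(y, ·) H_W(x, dy)`. -/
  compatible : ∀ V ∈ 𝒱, ∀ W ∈ 𝒱, W ⊆ V → (H V) ∘ₖ (H W) = H V
  /-- `H_V` maps continuous real functions to continuous functions. -/
  feller : ∀ V ∈ 𝒱, ∀ f : X → ℝ, Continuous f → Continuous fun x => ∫ y, f y ∂(H V x)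
  /-- `H_V 1 = 1`. -/
  normal : ∀ V ∈ 𝒱, ∀ x, H V x univ = 1
  /-- The positive `𝒲`-hyperharmonic functions on `V` separate the points of `V`, for some local
  choice `𝒲` in `V`. -/
  separation : ∀ V ∈ 𝒱, ∃ 𝒲 : X → Set (Set X), IsLocalChoice 𝒱 V 𝒲 ∧
    ∀ x ∈ V, ∀ y ∈ V, x ≠ y →
      ∃ u : X → EReal, HyperharmonicFor H 𝒲 V u ∧ (∀ z ∈ V, 0 ≤ u z) ∧ u x ≠ u y
  /-- `H_V f` is continuous on `V` for every bounded Borel function `f`. -/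
  strong_feller : ∀ V ∈ 𝒱, ∀ f : X → ℝ, Measurable f → (∃ C, ∀ x, |f x| ≤ C) →
    ContinuousOn (fun x => ∫ y, f y ∂(H V x)) V

/-- `𝒫`-sets: open sets `U` such that the positive hyperharmonic functions on `U` separate the
points of `U`. -/
def IsPSet (𝒱 : Set (Set X)) (H : Set X → Kernel X X) (U : Set X) : Prop :=
  IsOpen U ∧ ∀ x ∈ U, ∀ y ∈ U, x ≠ y →
    ∃ u : X → EReal, Hyperharmonic 𝒱 H U u ∧ (∀ z ∈ U, 0 ≤ u z) ∧ u x ≠ u y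

/-- Regular sets: relatively compact open sets `U` such that every continuous real function `f` on
`∂U` has a unique continuous extension to `closure U` which is harmonic on `U`, and this extension
is positive if `f` is positive. -/
def IsRegular (𝒱 : Set (Set X)) (H : Set X → Kernel X X) (U : Set X) : Prop :=
  IsOpen U ∧ IsCompact (closure U) ∧
    ∀ f : X → ℝ, ContinuousOn f (frontier U) →
      ∃ h : X → ℝ,
        (ContinuousOn h (closure U) ∧ EqOn h f (frontier U) ∧ Harmonic 𝒱 H U h) ∧
        (∀ h' : X → ℝ, ContinuousOn h' (closure U) → EqOn h' f (frontier U) →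
          Harmonic 𝒱 H U h' → EqOn h' h (closure U)) ∧
        ((∀ z ∈ frontier U, 0 ≤ f z) → ∀ x ∈ closure U, 0 ≤ h x)

/-- Ellipticity: every positive harmonic function on a connected open set is identically zero
or strictly positive. -/
def IsElliptic (𝒱 : Set (Set X)) (H : Set X → Kernel X X) : Prop :=
  ∀ U : Set X, IsOpen U → IsConnected U → ∀ h : X → ℝ, Harmonic 𝒱 H U h →
    (∀ x ∈ U, 0 ≤ h x) → (∀ x ∈ U, h x = 0) ∨ ∀ x ∈ U, 0 < h x

end Bauer

end

/-! Two constructions carry the theorem: a neighborhood of `K` whose boundary points all have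
barriers, and the solution of the Dirichlet problem on any such neighborhood by reduced functions
(obstacle problems).

The basic tool is `minimum_principle`. If a function satisfying local inequalities `H_V u ≤ u` had a
negative minimum, the harmonic measures at its minimum points would live on the minimum set. A Zorn
argument with the separating functions then yields a point whose harmonic measures all sit at that
point, although they must be carried by `∂V`.

The reduced function `R` of a bounded continuous obstacle `φ` is built from below by maxima and
sweeps. It is superharmonic, minimal among superharmonic majorants, continuous by the strong Feller
property, and harmonic where `φ ≤ H_V R`.

Barriers: near each boundary point of a neighborhood `G` of `K`, `exists_potential` gives `q = p -
H_V p`, with `p` the reduced function of a bump. This `q` vanishes on `∂V` and is harmonic off a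
compact `C`; ellipticity makes it exceed some `a > 0` on `C` and at the point. Removing finitely
many sets `{q ≥ a}` from `G` leaves a set `U` whose boundary lies on level sets `{q = a}` outside
`C`, so `a - q` is a barrier.

Solving: for `p` continuous and superharmonic, the reduced function of `-p` in `U` is harmonic
because the obstacle is subharmonic, and a Bouligand-type argument (`eventually_reduced_le`) shows
that it attains its boundary values. Differences of such `p` are dense in `C(∂U)` by the lattice
Stone–Weierstrass theorem, and the minimum principle carries solvability to uniform limits. -/

set_option linter.unusedSectionVars false

/-! ### Harmonic measures and the boundary minimum principle. -/

noncomputable section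

namespace Bauer

variable {X : Type*} [MeasurableSpace X] {H : Set X → Kernel X X} {V : Set X}

/-- The function `H_V f`, that is, `x ↦ ∫ f dH_V(x, ·)`. -/
def sweep (H : Set X → Kernel X X) (V : Set X) (f : X → ℝ) (x : X) : ℝ := ∫ y, f y ∂(H V x)

theorem measurable_sweep {f : X → ℝ} (hf : Measurable f) :
    Measurable (sweep H V f) :=
  (hf.stronglyMeasurable.integral_kernel (κ := H V)).measurable

theorem sweep_add {x : X} {f g : X → ℝ} (hf : Integrable f (H V x)) (hg : Integrable g (H V x)) :
    sweep H V (fun y => f y + g y) x = sweep H V f x + sweep H V g x := integral_add hf hg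

theorem sweep_sub {x : X} {f g : X → ℝ} (hf : Integrable f (H V x)) (hg : Integrable g (H V x)) :
    sweep H V (fun y => f y - g y) x = sweep H V f x - sweep H V g x := integral_sub hf hg

theorem sweep_const_mul (x : X) (c : ℝ) (f : X → ℝ) :
    sweep H V (fun y => c * f y) x = c * sweep H V f x := integral_const_mul c f

theorem sweep_neg (x : X) (f : X → ℝ) :
    sweep H V (fun y => -f y) x = -sweep H V f x := integral_neg f

variable [TopologicalSpace X] {𝒱 : Set (Set X)} {U W : Set X}

/-- If a lower semicontinuous family with `∫ w dμ ≤ w x` for `μ ∈ 𝒩 x` separates the points of a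
compact set carrying all these measures, then some point carries its own measures. -/
theorem exists_measure_compl_singleton_eq_zero [T2Space X] [SecondCountableTopology X]
    [BorelSpace X] {M : Set X} (hM : IsCompact M) (hne : M.Nonempty) (𝒩 : X → Set (Measure X))
    (hp : ∀ x ∈ M, ∀ μ ∈ 𝒩 x, IsProbabilityMeasure μ) (hc : ∀ x ∈ M, ∀ μ ∈ 𝒩 x, μ Mᶜ = 0)
    (hsep : ∀ x ∈ M, ∀ y ∈ M, x ≠ y → ∃ w : X → ENNReal, LowerSemicontinuousOn w M ∧
      (∀ x ∈ M, ∀ μ ∈ 𝒩 x, ∫⁻ z, w z ∂μ ≤ w x) ∧ w x ≠ w y) :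
    ∃ x ∈ M, ∀ μ ∈ 𝒩 x, μ {x}ᶜ = 0 := by
  -- Absorbing sets: nonempty closed subsets of `M` that carry the measures of all their points. A
  -- minimal one will be a single point.
  let S : Set (Set X) := {F | F.Nonempty ∧ IsClosed F ∧ F ⊆ M ∧ ∀ x ∈ F, ∀ μ ∈ 𝒩 x, μ Fᶜ = 0}
  obtain ⟨F, -, hF⟩ := zorn_superset_nonempty S (by
    intro c hcS hchain hcne
    refine ⟨⋂₀ c, ⟨?_, isClosed_sInter fun s hs => (hcS hs).2.1, ?_, ?_⟩,
      fun s hs => sInter_subset_of_mem hs⟩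
    · have : Nonempty c := hcne.to_subtype
      rw [sInter_eq_iInter]
      refine IsCompact.nonempty_iInter_of_directed_nonempty_isCompact_isClosed
        (fun s : c => (s : Set X)) ?_ (fun s => (hcS s.2).1)
        (fun s => hM.of_isClosed_subset (hcS s.2).2.1 (hcS s.2).2.2.1) (fun s => (hcS s.2).2.1)
      intro s t
      rcases hchain.total s.2 t.2 with h | h
      · exact ⟨s, subset_rfl, h⟩
      · exact ⟨t, h, subset_rfl⟩
    · obtain ⟨s, hs⟩ := hcne
      exact (sInter_subset_of_mem hs).trans (hcS hs).2.2.1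
    · intro x hx μ hμ
      rw [compl_sInter]
      -- Second countability reduces the union of the complements to a countable one, so it remains
      -- a null set.
      obtain ⟨T, hTc, hTs, hTU⟩ := TopologicalSpace.isOpen_sUnion_countable (compl '' c) (by
        rintro _ ⟨s, hs, rfl⟩
        exact (hcS hs).2.1.isOpen_compl)
      rw [← hTU]
      refine (measure_sUnion_null_iff hTc).2 ?_
      intro t ht
      obtain ⟨s, hs, rfl⟩ := hTs ht
      exact (hcS hs).2.2.2 x (hx s hs) μ hμ) M ⟨hne, hM.isClosed, subset_rfl, hc⟩
  obtain ⟨⟨x, hxF⟩, hFc, hFM, hFa⟩ := hF.prop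
  have hsub : F.Subsingleton := by
    intro x hx y hy
    by_contra hxy
    obtain ⟨w, hwl, hwi, hwxy⟩ := hsep x (hFM hx) y (hFM hy) hxy
    have hwF := hwl.mono hFM
    obtain ⟨a, haF, ha⟩ := hwF.exists_isMinOn ⟨x, hx⟩ (hM.of_isClosed_subset hFc hFM)
    have ha' : ∀ z ∈ F, w a ≤ w z := fun z hz => ha hz
    rcases eq_or_ne (w a) ⊤ with htop | htop
    · exact hwxy ((top_le_iff.1 (htop ▸ ha' x hx)).trans (top_le_iff.1 (htop ▸ ha' y hy)).symm)
    obtain ⟨v, hv, hvF⟩ := lowerSemicontinuousOn_iff_preimage_Iic.1 hwF (w a)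
    have hclosed : IsClosed (F ∩ w ⁻¹' Iic (w a)) := hvF ▸ hFc.inter hv
    classical
    -- `w` is only controlled on `M` and need not be measurable. Setting it to `⊤` off the closed
    -- set `F` keeps it lower semicontinuous, hence Borel.
    let w' : X → ENNReal := fun z => if z ∈ F then w z else ⊤
    have hw' : Measurable w' := by
      refine LowerSemicontinuous.measurable ?_
      refine lowerSemicontinuous_iff_isClosed_preimage.2 fun b => ?_
      rcases eq_or_ne b ⊤ with rfl | hb
      · simp
      obtain ⟨v, hv, hvF⟩ := lowerSemicontinuousOn_iff_preimage_Iic.1 hwF b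
      have : w' ⁻¹' Iic b = F ∩ v := by
        rw [← hvF]
        ext z
        by_cases hz : z ∈ F <;> simp [w', hz, hb]
      rw [this]
      exact hFc.inter hv
    have hmem : F ∩ w ⁻¹' Iic (w a) ∈ S := by
      refine ⟨⟨a, haF, le_refl (w a)⟩, hclosed, inter_subset_left.trans hFM, ?_⟩
      rintro z ⟨hzF, hza⟩ μ hμ
      have := hp z (hFM hzF) μ hμ
      have haeF : ∀ᵐ y ∂μ, y ∈ F := (hFa z hzF μ hμ)
      have hww' : w' =ᵐ[μ] w := by
        filter_upwards [haeF] with y hy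
        simp [w', hy]
      -- The mean of `w` is at most its finite minimum over `F`, so `w` equals that minimum almost
      -- everywhere. The minimum set is therefore absorbing, and by minimality it is all of `F`.
      have key : (fun _ => w a) =ᵐ[μ] w' := by
        refine ae_eq_of_ae_le_of_lintegral_le ?_ ?_ hw'.aemeasurable ?_
        · filter_upwards [haeF] with y hy
          simpa [w', hy] using ha' y hy
        · simpa using htop
        · rw [lintegral_congr_ae hww']
          simpa using (hwi z (hFM hzF) μ hμ).trans hza
      have : ∀ᵐ y ∂μ, y ∈ F ∩ w ⁻¹' Iic (w a) := by
        filter_upwards [haeF, key, hww'] with y hy h1 h2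
        exact ⟨hy, (h1.trans h2).ge⟩
      exact this
    have hle : F ⊆ F ∩ w ⁻¹' Iic (w a) := hF.le_of_le hmem inter_subset_left
    exact hwxy (((hle hx).2.antisymm (ha' x hx)).trans ((hle hy).2.antisymm (ha' y hy)).symm)
  have hFx : F = {x} := hsub.eq_singleton_of_mem hxF
  exact ⟨x, hFM hxF, fun μ hμ => hFx ▸ hFa x hxF μ hμ⟩

namespace IsNormalBauerFamily

theorem isOpen (hN : IsNormalBauerFamily 𝒱 H) (hV : V ∈ 𝒱) : IsOpen V := hN.basis.isOpen hV

theorem isProbabilityMeasure (hN : IsNormalBauerFamily 𝒱 H) (hV : V ∈ 𝒱) (x : X) :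
    IsProbabilityMeasure (H V x) := ⟨hN.normal V hV x⟩

theorem ae_mem_frontier (hN : IsNormalBauerFamily 𝒱 H) (hV : V ∈ 𝒱) {x : X} (hx : x ∈ V) :
    ∀ᵐ y ∂(H V x), y ∈ frontier V := (hN.boundary V hV).1 x hx

theorem exists_mem_closure_subset [T2Space X] [LocallyCompactSpace X]
    (hN : IsNormalBauerFamily 𝒱 H) {x : X} {N : Set X} (hx : N ∈ 𝓝 x) :
    ∃ V ∈ 𝒱, x ∈ V ∧ closure V ⊆ N := by
  obtain ⟨C, hC, hCc, hCN⟩ := exists_mem_nhds_isClosed_subset hx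
  obtain ⟨V, hV, hxV, hVC⟩ := hN.basis.mem_nhds_iff.1 hC
  exact ⟨V, hV, hxV, (closure_minimal hVC hCc).trans hCN⟩

theorem frontier_nonempty (hN : IsNormalBauerFamily 𝒱 H) (hV : V ∈ 𝒱) {x : X} (hx : x ∈ V) :
    (frontier V).Nonempty := by
  have := hN.isProbabilityMeasure hV x
  obtain ⟨y, hy⟩ := (hN.ae_mem_frontier hV hx).exists
  exact ⟨y, hy⟩

theorem sweep_of_notMem [T2Space X] [BorelSpace X] (hN : IsNormalBauerFamily 𝒱 H) (hV : V ∈ 𝒱) {x : X} (hx : x ∉ V)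
    (f : X → ℝ) : sweep H V f x = f x := by
  rw [sweep, (hN.boundary V hV).2 x hx, integral_dirac]

theorem sweep_const (hN : IsNormalBauerFamily 𝒱 H) (hV : V ∈ 𝒱) (c : ℝ) (x : X) :
    sweep H V (fun _ => c) x = c := by
  have := hN.isProbabilityMeasure hV x
  simp [sweep]

theorem sweep_congr (hN : IsNormalBauerFamily 𝒱 H) (hV : V ∈ 𝒱) {x : X} (hx : x ∈ V)
    {f g : X → ℝ} (h : EqOn f g (frontier V)) : sweep H V f x = sweep H V g x :=
  integral_congr_ae ((hN.ae_mem_frontier hV hx).mono h)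

theorem sweep_mono (hN : IsNormalBauerFamily 𝒱 H) (hV : V ∈ 𝒱) {x : X} (hx : x ∈ V)
    {f g : X → ℝ} (hf : Integrable f (H V x)) (hg : Integrable g (H V x))
    (h : ∀ y ∈ frontier V, f y ≤ g y) : sweep H V f x ≤ sweep H V g x :=
  integral_mono_ae hf hg ((hN.ae_mem_frontier hV hx).mono h)

/-- Bounded Borel functions are integrable with respect to harmonic measures. -/
theorem integrable (hN : IsNormalBauerFamily 𝒱 H) (hV : V ∈ 𝒱) (x : X) {f : X → ℝ}
    (hf : Measurable f) {C : ℝ} (hC : ∀ y, |f y| ≤ C) : Integrable f (H V x) := by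
  have := hN.isProbabilityMeasure hV x
  exact Integrable.of_bound hf.aestronglyMeasurable C (.of_forall hC)

/-- Functions continuous on `∂V` are integrable with respect to harmonic measures of `V`. -/
theorem integrable_of_continuousOn [T2Space X] [BorelSpace X] (hN : IsNormalBauerFamily 𝒱 H) (hV : V ∈ 𝒱)
    {x : X} (hx : x ∈ V) {f : X → ℝ} (hf : ContinuousOn f (frontier V)) :
    Integrable f (H V x) := by
  have := hN.isProbabilityMeasure hV x
  have hc : IsCompact (frontier V) :=
    (hN.compact_closure V hV).of_isClosed_subset isClosed_frontier frontier_subset_closure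
  have := hf.integrableOn_compact (μ := H V x) hc
  rwa [IntegrableOn, Measure.restrict_eq_self_of_ae_mem (hN.ae_mem_frontier hV hx)] at this

theorem abs_sweep_le (hN : IsNormalBauerFamily 𝒱 H) (hV : V ∈ 𝒱) {f : X → ℝ} {C : ℝ}
    (hC : ∀ y, |f y| ≤ C) (x : X) : |sweep H V f x| ≤ C := by
  have := hN.isProbabilityMeasure hV x
  simpa [sweep] using norm_integral_le_of_norm_le_const (μ := H V x) (f := f) (.of_forall hC)

theorem sweep_sweep (hN : IsNormalBauerFamily 𝒱 H) (hV : V ∈ 𝒱) (hW : W ∈ 𝒱) (hWV : W ⊆ V)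
    {f : X → ℝ} (hf : Measurable f) {C : ℝ} (hC : ∀ y, |f y| ≤ C) (x : X) :
    sweep H W (sweep H V f) x = sweep H V f x := by
  have h := Kernel.integral_comp (a := x) (κ := H W) (η := H V) (f := f)
    (by rw [hN.compatible V hV W hW hWV]; exact hN.integrable hV x hf hC)
  rw [hN.compatible V hV W hW hWV] at h
  exact h.symm

/-- Dominated convergence for `sweep`. -/
theorem tendsto_sweep (hN : IsNormalBauerFamily 𝒱 H) (hV : V ∈ 𝒱) {f : ℕ → X → ℝ} {g : X → ℝ}
    (hf : ∀ n, Measurable (f n)) {C : ℝ} (hC : ∀ n y, |f n y| ≤ C)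
    (h : ∀ y, Filter.Tendsto (fun n => f n y) Filter.atTop (𝓝 (g y))) (x : X) :
    Filter.Tendsto (fun n => sweep H V (f n) x) Filter.atTop (𝓝 (sweep H V g x)) := by
  have := hN.isProbabilityMeasure hV x
  exact tendsto_integral_of_dominated_convergence (fun _ => C)
    (fun n => (hf n).aestronglyMeasurable) (integrable_const C) (fun n => .of_forall (hC n))
    (.of_forall h)

end IsNormalBauerFamily

/-- The separating functions of a `𝒫`-set, as functions with values in `[0, ∞]`. -/
theorem IsPSet.exists_ennreal (hN : IsNormalBauerFamily 𝒱 H) (hW : IsPSet 𝒱 H W) {x y : X}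
    (hx : x ∈ W) (hy : y ∈ W) (hxy : x ≠ y) :
    ∃ w : X → ENNReal, LowerSemicontinuousOn w W ∧
      (∀ z ∈ W, ∀ V ∈ inside 𝒱 W, z ∈ V → ∫⁻ t, w t ∂(H V z) ≤ w z) ∧ w x ≠ w y := by
  obtain ⟨v, ⟨-, hl, hi⟩, hpos, hne⟩ := hW.2 x hx y hy hxy
  refine ⟨fun z => (v z).toENNReal, ?_, ?_, ?_⟩
  · exact EReal.continuous_toENNReal.comp_lowerSemicontinuousOn hl
      fun a b hab => EReal.toENNReal_le_toENNReal hab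
  · intro z hz V hV hzV
    have h := hi z hz V ⟨hV, hzV⟩
    have h0 : ∫⁻ t, (-v t).toENNReal ∂(H V z) = 0 := by
      rw [lintegral_congr_ae (g := fun _ => 0), lintegral_zero]
      filter_upwards [hN.ae_mem_frontier hV.1 hzV] with t ht
      exact EReal.toENNReal_of_nonpos
        (EReal.neg_le_zero.2 (hpos t (hV.2 (frontier_subset_closure ht))))
    rw [eintegral, h0, EReal.coe_ennreal_zero, sub_zero] at h
    have := EReal.toENNReal_le_toENNReal h
    rwa [EReal.toENNReal_coe] at this
  · intro h
    apply hne
    rw [← EReal.coe_toENNReal (hpos x hx), ← EReal.coe_toENNReal (hpos y hy)]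
    exact congrArg _ h

/-- The boundary minimum principle for relatively compact open sets in a `𝒫`-set. -/
theorem minimum_principle [T2Space X] [SecondCountableTopology X] [BorelSpace X]
    (hN : IsNormalBauerFamily 𝒱 H) (hW : IsPSet 𝒱 H W)
    (hUc : IsCompact (closure U)) (hUW : closure U ⊆ W) (hU : IsOpen U) {u : X → ℝ}
    (hu : LowerSemicontinuousOn u (closure U)) (hb : ∀ z ∈ frontier U, 0 ≤ u z)
    (hs : ∀ x ∈ U, ∃ V ∈ inside 𝒱 U, x ∈ V ∧ Integrable u (H V x) ∧ sweep H V u x ≤ u x) :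
    ∀ x ∈ closure U, 0 ≤ u x := by
  intro x₀ hx₀
  obtain ⟨a, haU, ha⟩ := hu.exists_isMinOn ⟨x₀, hx₀⟩ hUc
  have ha' : ∀ z ∈ closure U, u a ≤ u z := fun z hz => ha hz
  refine le_trans ?_ (ha' x₀ hx₀)
  by_contra! hneg
  obtain ⟨v, hv, hvU⟩ := lowerSemicontinuousOn_iff_preimage_Iic.1 hu (u a)
  set M := closure U ∩ u ⁻¹' Iic (u a) with hMdef
  have hMc : IsCompact M := by
    rw [hvU]
    exact hUc.inter_right hv
  have hMU : M ⊆ U := by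
    rintro z ⟨hz, hza⟩
    by_contra hzU
    have : z ∈ frontier U := by rw [hU.frontier_eq]; exact ⟨hz, hzU⟩
    exact absurd (hb z this) (not_le.2 (lt_of_le_of_lt hza hneg))
  -- At a minimum point, `∫ u dμ ≤ u x` with `u` minimal forces `u` to be minimal almost everywhere,
  -- so these measures are carried by `M`.
  let 𝒩 : X → Set (Measure X) := fun x => {μ | ∃ V ∈ inside 𝒱 U, x ∈ V ∧ μ = H V x ∧
    Integrable u (H V x) ∧ sweep H V u x ≤ u x}
  obtain ⟨x, hxM, hx⟩ := exists_measure_compl_singleton_eq_zero hMc ⟨a, haU, le_refl (u a)⟩ 𝒩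
    (by
      rintro x hx _ ⟨V, hV, hxV, rfl, -⟩
      exact hN.isProbabilityMeasure hV.1 x)
    (by
      rintro x hx _ ⟨V, hV, hxV, rfl, hint, hle⟩
      have := hN.isProbabilityMeasure hV.1 x
      have hfr : ∀ᵐ y ∂(H V x), y ∈ closure U := by
        filter_upwards [hN.ae_mem_frontier hV.1 hxV] with y hy
        exact subset_closure (hV.2 (frontier_subset_closure hy))
      have hnn : 0 ≤ᵐ[H V x] fun y => u y - u a := by
        filter_upwards [hfr] with y hy
        exact sub_nonneg.2 (ha' y hy)
      have hint' : Integrable (fun y => u y - u a) (H V x) := hint.sub (integrable_const _)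
      have hzero : ∫ y, (u y - u a) ∂(H V x) = 0 := by
        refine le_antisymm ?_ (integral_nonneg_of_ae hnn)
        rw [integral_sub hint (integrable_const _)]
        have h1 : ∫ y, u y ∂(H V x) ≤ u x := hle
        have h2 : u x ≤ u a := hx.2
        simp
        linarith
      have h0 := (integral_eq_zero_iff_of_nonneg_ae hnn hint').1 hzero
      have : ∀ᵐ y ∂(H V x), y ∈ M := by
        filter_upwards [hfr, h0] with y hy h0
        exact ⟨hy, (sub_eq_zero.1 h0).le⟩
      exact this)
    (by
      intro x hx y hy hxy
      have hMW : M ⊆ W := hMU.trans (subset_closure.trans hUW)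
      obtain ⟨w, hw, hwi, hne⟩ := hW.exists_ennreal hN (hMW hx) (hMW hy) hxy
      refine ⟨w, hw.mono hMW, ?_, hne⟩
      rintro z hz _ ⟨V, hV, hzV, rfl, -⟩
      exact hwi z (hMW hz) V ⟨hV.1, hV.2.trans (subset_closure.trans hUW)⟩ hzV)
  obtain ⟨V, hV, hxV, hint, hle⟩ := hs x (hMU hxM)
  have h0 := hx _ ⟨V, hV, hxV, rfl, hint, hle⟩
  have := hN.isProbabilityMeasure hV.1 x
  have h0' : ∀ᵐ y ∂(H V x), y = x := h0
  obtain ⟨y, hy, hyx⟩ := ((hN.ae_mem_frontier hV.1 hxV).and h0').exists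
  rw [(hN.isOpen hV.1).frontier_eq] at hy
  exact hy.2 (hyx ▸ hxV)

end Bauer

end

/-! ### Reduced functions: minimality, harmonicity and continuity. -/

noncomputable section

namespace Bauer

variable {X : Type*} [TopologicalSpace X] [MeasurableSpace X] {𝒱 : Set (Set X)}
  {H : Set X → Kernel X X} {U V W Ω : Set X}

/-- Bounded Borel functions which are lower semicontinuous on `Ω` and satisfy `H_V s (x) ≤ s x`
for arbitrarily small `V ∈ 𝒱` containing `x`, for every `x ∈ Ω`. -/
structure LocallySuperharmonic (𝒱 : Set (Set X)) (H : Set X → Kernel X X) (Ω : Set X)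
    (s : X → ℝ) : Prop where
  measurable : Measurable s
  bounded : ∃ C, ∀ x, |s x| ≤ C
  lsc : LowerSemicontinuousOn s Ω
  sweep_le_self : ∀ x ∈ Ω, ∀ N ∈ 𝓝 x, ∃ V ∈ 𝒱, x ∈ V ∧ closure V ⊆ N ∧ sweep H V s x ≤ s x

theorem inside_mono (h : U ⊆ W) : inside 𝒱 U ⊆ inside 𝒱 W := fun _ hV => ⟨hV.1, hV.2.trans h⟩

/-- The minimum principle on `V` applies to `s - H_V f`: its boundary values are `s - f ≥ 0`, and
`H_V f` is invariant under smaller sweeps. This turns the local inequalities for `s` into one for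
every `V ∈ 𝒱(Ω)`. -/
theorem LocallySuperharmonic.sweep_le [T2Space X] [SecondCountableTopology X] [BorelSpace X]
    {s : X → ℝ} (hs : LocallySuperharmonic 𝒱 H Ω s) (hN : IsNormalBauerFamily 𝒱 H)
    (hW : IsPSet 𝒱 H W) (hΩW : Ω ⊆ W) {f : X → ℝ} (hf : Continuous f) {C : ℝ}
    (hC : ∀ x, |f x| ≤ C) (hfs : ∀ x ∈ Ω, f x ≤ s x) (hV : V ∈ inside 𝒱 Ω) {x : X} (hx : x ∈ V) :
    sweep H V f x ≤ s x := by
  have hsf : Continuous (sweep H V f) := hN.feller V hV.1 f hf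
  have hmin := minimum_principle (u := fun y => s y + -sweep H V f y) hN hW
    (hN.compact_closure V hV.1) (hV.2.trans hΩW) (hN.isOpen hV.1)
    ((hs.lsc.mono hV.2).add
      (hsf.neg.lowerSemicontinuous.lowerSemicontinuousOn _))
    (by
      intro z hz
      have hzV : z ∉ V := fun h => by
        rw [(hN.isOpen hV.1).frontier_eq] at hz
        exact hz.2 h
      rw [hN.sweep_of_notMem hV.1 hzV]
      linarith [hfs z (hV.2 (frontier_subset_closure hz))])
    (by
      intro y hy
      obtain ⟨V', hV', hyV', hcl, hle⟩ := hs.sweep_le_self y (hV.2 (subset_closure hy)) V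
        ((hN.isOpen hV.1).mem_nhds hy)
      obtain ⟨D, hD⟩ := hs.bounded
      have h1 := hN.integrable hV' y hs.measurable hD
      have h2 : Integrable (fun z => -sweep H V f z) (H V' y) :=
        hN.integrable_of_continuousOn hV' hyV' hsf.neg.continuousOn
      refine ⟨V', ⟨hV', hcl⟩, hyV', h1.add h2, ?_⟩
      rw [sweep_add h1 h2, sweep_neg,
        hN.sweep_sweep hV.1 hV' (subset_closure.trans hcl) hf.measurable hC]
      linarith)
  have := hmin x (subset_closure hx)
  linarith

theorem lowerSemicontinuous_of_tendsto {g : ℕ → X → ℝ} {f : X → ℝ} (hg : ∀ n, Continuous (g n))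
    (hle : ∀ n x, g n x ≤ f x)
    (h : ∀ x, Filter.Tendsto (fun n => g n x) Filter.atTop (𝓝 (f x))) :
    LowerSemicontinuous f := by
  intro x c hc
  obtain ⟨n, hn⟩ := ((h x).eventually (lt_mem_nhds hc)).exists
  filter_upwards [(hg n).continuousAt.eventually (lt_mem_nhds hn)] with y hy
  exact hy.trans_le (hle n y)

/-- The functions obtained from `φ` by finitely many maxima and operators `H_V`, `V ∈ 𝒱(Ω)`. -/
inductive IsIteratedSweep (𝒱 : Set (Set X)) (H : Set X → Kernel X X) (Ω : Set X) (φ : X → ℝ) :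
    (X → ℝ) → Prop
  | base : IsIteratedSweep 𝒱 H Ω φ φ
  | sup {f g : X → ℝ} : IsIteratedSweep 𝒱 H Ω φ f → IsIteratedSweep 𝒱 H Ω φ g →
      IsIteratedSweep 𝒱 H Ω φ (f ⊔ g)
  | sweep {f : X → ℝ} {V : Set X} : V ∈ inside 𝒱 Ω → IsIteratedSweep 𝒱 H Ω φ f →
      IsIteratedSweep 𝒱 H Ω φ (sweep H V f)

/-- The reduced function of `φ` in `Ω`: the smallest superharmonic majorant of `φ`. -/
def reduced (𝒱 : Set (Set X)) (H : Set X → Kernel X X) (Ω : Set X) (φ : X → ℝ) (x : X) : ℝ :=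
  ⨆ f : {f : X → ℝ // IsIteratedSweep 𝒱 H Ω φ f}, f.1 x

namespace IsIteratedSweep

variable {φ g : X → ℝ} {M : ℝ}

theorem continuous (hg : IsIteratedSweep 𝒱 H Ω φ g) (hN : IsNormalBauerFamily 𝒱 H)
    (hφ : Continuous φ) : Continuous g := by
  induction hg with
  | base => exact hφ
  | sup _ _ h1 h2 => exact h1.sup h2
  | sweep hV _ h => exact hN.feller _ hV.1 _ h

theorem abs_apply_le (hg : IsIteratedSweep 𝒱 H Ω φ g) (hN : IsNormalBauerFamily 𝒱 H)
    (hM : ∀ x, |φ x| ≤ M) (x : X) : |g x| ≤ M := by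
  induction hg generalizing x with
  | base => exact hM x
  | sup _ _ h1 h2 =>
    exact (abs_max_le_max_abs_abs).trans (max_le (h1 x) (h2 x))
  | sweep hV _ h => exact hN.abs_sweep_le hV.1 h x

theorem eq_of_notMem [T2Space X] [BorelSpace X] (hg : IsIteratedSweep 𝒱 H Ω φ g)
    (hN : IsNormalBauerFamily 𝒱 H) {x : X} (hx : x ∉ Ω) : g x = φ x := by
  induction hg with
  | base => rfl
  | sup _ _ h1 h2 => simp [h1, h2]
  | sweep hV _ h =>
    rw [hN.sweep_of_notMem hV.1 fun hxV => hx (hV.2 (subset_closure hxV)), h]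

theorem le_of_locallySuperharmonic [T2Space X] [SecondCountableTopology X] [BorelSpace X]
    (hg : IsIteratedSweep 𝒱 H Ω φ g) (hN : IsNormalBauerFamily 𝒱 H) (hW : IsPSet 𝒱 H W)
    (hΩW : Ω ⊆ W) (hφ : Continuous φ) (hM : ∀ x, |φ x| ≤ M) {s : X → ℝ}
    (hs : LocallySuperharmonic 𝒱 H Ω s) (h : ∀ x ∈ Ω, φ x ≤ s x) : ∀ x ∈ Ω, g x ≤ s x := by
  induction hg with
  | base => exact h
  | sup _ _ h1 h2 => exact fun x hx => max_le (h1 x hx) (h2 x hx)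
  | @sweep f V hV hf h =>
    intro x hx
    by_cases hxV : x ∈ V
    · exact hs.sweep_le hN hW hΩW (hf.continuous hN hφ) (hf.abs_apply_le hN hM) h hV hxV
    · rw [hN.sweep_of_notMem hV.1 hxV]
      exact h x hx

end IsIteratedSweep

section Reduced

variable {φ : X → ℝ} {M : ℝ}

theorem IsIteratedSweep.le_reduced {g : X → ℝ} (hg : IsIteratedSweep 𝒱 H Ω φ g)
    (hN : IsNormalBauerFamily 𝒱 H) (hM : ∀ x, |φ x| ≤ M) (x : X) : g x ≤ reduced 𝒱 H Ω φ x :=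
  le_ciSup (f := fun f : {f : X → ℝ // IsIteratedSweep 𝒱 H Ω φ f} => f.1 x)
    ⟨M, by rintro _ ⟨f, rfl⟩; exact (abs_le.1 (f.2.abs_apply_le hN hM x)).2⟩ ⟨g, hg⟩

theorem reduced_le {x : X} {c : ℝ} (h : ∀ g, IsIteratedSweep 𝒱 H Ω φ g → g x ≤ c) :
    reduced 𝒱 H Ω φ x ≤ c :=
  haveI : Nonempty {f : X → ℝ // IsIteratedSweep 𝒱 H Ω φ f} := ⟨⟨φ, .base⟩⟩
  ciSup_le fun f => h f.1 f.2

theorem le_reduced (hN : IsNormalBauerFamily 𝒱 H) (hM : ∀ x, |φ x| ≤ M) (x : X) :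
    φ x ≤ reduced 𝒱 H Ω φ x := IsIteratedSweep.base.le_reduced hN hM x

theorem abs_reduced_le (hN : IsNormalBauerFamily 𝒱 H) (hM : ∀ x, |φ x| ≤ M) (x : X) :
    |reduced 𝒱 H Ω φ x| ≤ M :=
  abs_le.2 ⟨(abs_le.1 (hM x)).1.trans (le_reduced hN hM x),
    reduced_le fun _ hg => (abs_le.1 (hg.abs_apply_le hN hM x)).2⟩

/-- The reduced function is the limit of an increasing sequence of iterated sweeps. -/
theorem exists_monotone_tendsto_reduced [LocallyCompactSpace X] [SecondCountableTopology X]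
    (hN : IsNormalBauerFamily 𝒱 H) (hφ : Continuous φ) (hM : ∀ x, |φ x| ≤ M) :
    ∃ g : ℕ → X → ℝ, (∀ n, IsIteratedSweep 𝒱 H Ω φ (g n)) ∧ Monotone g ∧
      ∀ x, Filter.Tendsto (fun n => g n x) Filter.atTop (𝓝 (reduced 𝒱 H Ω φ x)) := by
  -- `C(X, ℝ)` with the compact-open topology is second countable, so a dense sequence of iterated
  -- sweeps determines the supremum. Its partial maxima are again iterated sweeps.
  let S : Set C(X, ℝ) := {F | IsIteratedSweep 𝒱 H Ω φ F}
  have : Nonempty S := ⟨⟨⟨φ, hφ⟩, .base⟩⟩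
  let d : ℕ → X → ℝ := fun n => (TopologicalSpace.denseSeq S n : C(X, ℝ))
  have hd : ∀ n, IsIteratedSweep 𝒱 H Ω φ (d n) := fun n => (TopologicalSpace.denseSeq S n).2
  have hg : ∀ n, IsIteratedSweep 𝒱 H Ω φ (partialSups d n) := by
    intro n
    induction n with
    | zero => simpa using hd 0
    | succ n ih =>
      rw [partialSups_add_one]
      exact ih.sup (hd _)
  refine ⟨fun n => partialSups d n, hg, (partialSups d).monotone, fun x => ?_⟩
  have hbdd : BddAbove (range fun n => partialSups d n x) :=
    ⟨M, by rintro _ ⟨n, rfl⟩; exact (abs_le.1 ((hg n).abs_apply_le hN hM x)).2⟩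
  have hlim := tendsto_atTop_ciSup (f := fun n => partialSups d n x)
    (fun m n h => (partialSups d).monotone h x) hbdd
  convert hlim using 2
  refine le_antisymm (reduced_le fun f hf => ?_) (ciSup_le fun n => (hg n).le_reduced hN hM x)
  have hcl : IsClosed {F : S | (F : C(X, ℝ)) x ≤ ⨆ n, partialSups d n x} :=
    isClosed_le ((continuous_eval_const x).comp continuous_subtype_val)
      continuous_const
  have hsub : range (TopologicalSpace.denseSeq S) ⊆
      {F : S | (F : C(X, ℝ)) x ≤ ⨆ n, partialSups d n x} := by
    rintro _ ⟨n, rfl⟩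
    exact (le_partialSups d n x).trans (le_ciSup hbdd n)
  have huniv := (TopologicalSpace.denseRange_denseSeq S).closure_eq ▸ closure_minimal hsub hcl
  exact huniv (mem_univ (⟨⟨f, hf.continuous hN hφ⟩, hf⟩ : S))

theorem reduced_eq_of_notMem [T2Space X] [BorelSpace X] (hN : IsNormalBauerFamily 𝒱 H)
    (hM : ∀ x, |φ x| ≤ M) {x : X} (hx : x ∉ Ω) : reduced 𝒱 H Ω φ x = φ x :=
  le_antisymm (reduced_le fun _ hg => (hg.eq_of_notMem hN hx).le) (le_reduced hN hM x)

variable [T2Space X] [LocallyCompactSpace X] [SecondCountableTopology X] [BorelSpace X]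

theorem lowerSemicontinuous_reduced (hN : IsNormalBauerFamily 𝒱 H) (hφ : Continuous φ)
    (hM : ∀ x, |φ x| ≤ M) : LowerSemicontinuous (reduced 𝒱 H Ω φ) := by
  obtain ⟨g, hg, -, hlim⟩ := exists_monotone_tendsto_reduced (Ω := Ω) hN hφ hM
  exact lowerSemicontinuous_of_tendsto (fun n => (hg n).continuous hN hφ)
    (fun n => (hg n).le_reduced hN hM) hlim

theorem measurable_reduced (hN : IsNormalBauerFamily 𝒱 H) (hφ : Continuous φ)
    (hM : ∀ x, |φ x| ≤ M) : Measurable (reduced 𝒱 H Ω φ) :=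
  (lowerSemicontinuous_reduced hN hφ hM).measurable

theorem integrable_reduced (hN : IsNormalBauerFamily 𝒱 H) (hφ : Continuous φ)
    (hM : ∀ x, |φ x| ≤ M) (hV : V ∈ 𝒱) (x : X) : Integrable (reduced 𝒱 H Ω φ) (H V x) :=
  hN.integrable hV x (measurable_reduced hN hφ hM) (abs_reduced_le hN hM)

theorem lowerSemicontinuous_sweep_reduced (hN : IsNormalBauerFamily 𝒱 H) (hφ : Continuous φ)
    (hM : ∀ x, |φ x| ≤ M) (hV : V ∈ 𝒱) :
    LowerSemicontinuous (sweep H V (reduced 𝒱 H Ω φ)) := by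
  obtain ⟨g, hg, -, hlim⟩ := exists_monotone_tendsto_reduced (Ω := Ω) hN hφ hM
  refine lowerSemicontinuous_of_tendsto (g := fun n => sweep H V (g n))
    (fun n => hN.feller V hV _ ((hg n).continuous hN hφ)) (fun n x => ?_)
    (hN.tendsto_sweep hV (fun n => ((hg n).continuous hN hφ).measurable)
      (fun n => (hg n).abs_apply_le hN hM) hlim)
  exact integral_mono (hN.integrable hV x ((hg n).continuous hN hφ).measurable
    ((hg n).abs_apply_le hN hM)) (integrable_reduced hN hφ hM hV x) ((hg n).le_reduced hN hM)

/-- Reduced functions are superharmonic. -/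
theorem sweep_reduced_le (hN : IsNormalBauerFamily 𝒱 H) (hφ : Continuous φ)
    (hM : ∀ x, |φ x| ≤ M) (hV : V ∈ inside 𝒱 Ω) (x : X) :
    sweep H V (reduced 𝒱 H Ω φ) x ≤ reduced 𝒱 H Ω φ x := by
  obtain ⟨g, hg, -, hlim⟩ := exists_monotone_tendsto_reduced (Ω := Ω) hN hφ hM
  exact le_of_tendsto' (hN.tendsto_sweep hV.1 (fun n => ((hg n).continuous hN hφ).measurable)
    (fun n => (hg n).abs_apply_le hN hM) hlim x) fun n => ((hg n).sweep hV).le_reduced hN hM x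

theorem reduced_le_of_locallySuperharmonic (hN : IsNormalBauerFamily 𝒱 H) (hW : IsPSet 𝒱 H W)
    (hΩW : Ω ⊆ W) (hφ : Continuous φ) (hM : ∀ x, |φ x| ≤ M) {s : X → ℝ}
    (hs : LocallySuperharmonic 𝒱 H Ω s) (h : ∀ x ∈ Ω, φ x ≤ s x) {x : X} (hx : x ∈ Ω) :
    reduced 𝒱 H Ω φ x ≤ s x :=
  reduced_le fun _ hg => hg.le_of_locallySuperharmonic hN hW hΩW hφ hM hs h x hx

/-- If `φ ≤ H_V R + δ` on `V` for the reduced function `R` of `φ`, then `R ≤ H_V R + δ` there. -/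
theorem reduced_le_sweep_reduced_add (hN : IsNormalBauerFamily 𝒱 H) (hW : IsPSet 𝒱 H W)
    (hΩ : IsOpen Ω) (hΩW : Ω ⊆ W) (hφ : Continuous φ) (hM : ∀ x, |φ x| ≤ M)
    (hV : V ∈ inside 𝒱 Ω) {δ : ℝ} (hδ : 0 ≤ δ)
    (h : ∀ x ∈ V, φ x ≤ sweep H V (reduced 𝒱 H Ω φ) x + δ) {x : X} (hx : x ∈ V) :
    reduced 𝒱 H Ω φ x ≤ sweep H V (reduced 𝒱 H Ω φ) x + δ := by
  set R := reduced 𝒱 H Ω φ with hR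
  have hRm : Measurable R := measurable_reduced hN hφ hM
  have hRb : ∀ x, |R x| ≤ M := abs_reduced_le hN hM
  have hSm : Measurable (sweep H V R) := measurable_sweep hRm
  have hSb : ∀ x, |sweep H V R x| ≤ M := hN.abs_sweep_le hV.1 hRb
  have hsm : Measurable fun y => min (R y) (sweep H V R y + δ) :=
    hRm.min (hSm.add_const δ)
  have hsb : ∀ y, |min (R y) (sweep H V R y + δ)| ≤ M := fun y => by
    have h1 := abs_le.1 (hRb y)
    have h2 := abs_le.1 (hSb y)
    exact abs_le.2 ⟨le_min h1.1 (by linarith), (min_le_left _ _).trans h1.2⟩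
  -- Off `V` one has `H_V R = R`, so the minimum only lowers `R` inside `V`. It is still a
  -- superharmonic majorant of `φ`, and minimality of `R` gives the claim.
  have hs : LocallySuperharmonic 𝒱 H Ω fun y => min (R y) (sweep H V R y + δ) := by
    refine ⟨hsm, ⟨M, hsb⟩, ?_, fun y hy N hNy => ?_⟩
    · exact ((lowerSemicontinuous_reduced hN hφ hM).inf
        ((lowerSemicontinuous_sweep_reduced hN hφ hM hV.1).add
          lowerSemicontinuous_const)).lowerSemicontinuousOn _
    by_cases hyV : y ∈ V
    · obtain ⟨V', hV', hyV', hcl⟩ := hN.exists_mem_closure_subset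
        (Filter.inter_mem hNy ((hN.isOpen hV.1).mem_nhds hyV))
      have hclV : closure V' ⊆ V := hcl.trans inter_subset_right
      have hV'Ω : V' ∈ inside 𝒱 Ω := ⟨hV', hclV.trans (subset_closure.trans hV.2)⟩
      have hint := hN.integrable hV' y hsm hsb
      refine ⟨V', hV', hyV', hcl.trans inter_subset_left, le_min ?_ ?_⟩
      · exact (integral_mono hint (integrable_reduced hN hφ hM hV' y)
          fun z => min_le_left _ _).trans (sweep_reduced_le hN hφ hM hV'Ω y)
      · have := hN.isProbabilityMeasure hV' y
        have h1 := hN.integrable hV' y hSm hSb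
        refine (integral_mono hint (h1.add (integrable_const δ))
          fun z => min_le_right _ _).trans ?_
        change sweep H V' (fun z => sweep H V R z + δ) y ≤ _
        rw [sweep_add h1 (integrable_const δ), hN.sweep_const hV',
          hN.sweep_sweep hV.1 hV' (subset_closure.trans hclV) hRm hRb]
    · obtain ⟨V', hV', hyV', hcl⟩ := hN.exists_mem_closure_subset
        (Filter.inter_mem hNy (hΩ.mem_nhds hy))
      have hV'Ω : V' ∈ inside 𝒱 Ω := ⟨hV', hcl.trans inter_subset_right⟩
      refine ⟨V', hV', hyV', hcl.trans inter_subset_left, ?_⟩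
      rw [hN.sweep_of_notMem hV.1 hyV, min_eq_left (by linarith)]
      exact (integral_mono (hN.integrable hV' y hsm hsb) (integrable_reduced hN hφ hM hV' y)
        fun z => min_le_left _ _).trans (sweep_reduced_le hN hφ hM hV'Ω y)
  refine (reduced_le_of_locallySuperharmonic hN hW hΩW hφ hM hs (fun y _ => ?_)
    (hV.2 (subset_closure hx))).trans (min_le_right _ _)
  refine le_min (le_reduced hN hM y) ?_
  by_cases hyV : y ∈ V
  · exact h y hyV
  · rw [hN.sweep_of_notMem hV.1 hyV]
    linarith [le_reduced (Ω := Ω) hN hM y]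

/-- The case `δ = 0`. It serves both where a positive obstacle has `φ = 0` and where the obstacle is
subharmonic. -/
theorem sweep_reduced_eq (hN : IsNormalBauerFamily 𝒱 H) (hW : IsPSet 𝒱 H W)
    (hΩ : IsOpen Ω) (hΩW : Ω ⊆ W) (hφ : Continuous φ) (hM : ∀ x, |φ x| ≤ M)
    (hV : V ∈ inside 𝒱 Ω) (h : ∀ x ∈ V, φ x ≤ sweep H V (reduced 𝒱 H Ω φ) x) {x : X}
    (hx : x ∈ V) : sweep H V (reduced 𝒱 H Ω φ) x = reduced 𝒱 H Ω φ x := by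
  refine le_antisymm (sweep_reduced_le hN hφ hM hV x) ?_
  simpa using reduced_le_sweep_reduced_add hN hW hΩ hΩW hφ hM hV le_rfl (by simpa using h) hx

/-- On a small `V` the obstacle is nearly constant, so `φ ≤ H_V R + ε/4` and hence `H_V R ≤ R ≤ H_V
R + ε/4`. Since `H_V R` is continuous on `V` by the strong Feller property, `R` is locally a uniform
limit of continuous functions. -/
theorem continuousOn_reduced (hN : IsNormalBauerFamily 𝒱 H) (hW : IsPSet 𝒱 H W)
    (hΩ : IsOpen Ω) (hΩW : Ω ⊆ W) (hφ : Continuous φ) (hM : ∀ x, |φ x| ≤ M) :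
    ContinuousOn (reduced 𝒱 H Ω φ) Ω := by
  intro x hx
  refine ContinuousAt.continuousWithinAt ?_
  rw [Metric.continuousAt_iff']
  intro ε hε
  obtain ⟨V, hV, hxV, hcl⟩ := hN.exists_mem_closure_subset (Filter.inter_mem (hΩ.mem_nhds hx)
    (hφ.continuousAt.preimage_mem_nhds (Metric.ball_mem_nhds (φ x) (by positivity : 0 < ε / 8))))
  have hVΩ : V ∈ inside 𝒱 Ω := ⟨hV, hcl.trans inter_subset_left⟩
  have hosc : ∀ y ∈ closure V, |φ y - φ x| < ε / 8 := fun y hy => by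
    simpa [Real.dist_eq] using (hcl hy).2
  have key : ∀ y ∈ V, reduced 𝒱 H Ω φ y ≤ sweep H V (reduced 𝒱 H Ω φ) y + ε / 4 := by
    intro y hy
    refine reduced_le_sweep_reduced_add hN hW hΩ hΩW hφ hM hVΩ (by positivity) (fun z hz => ?_) hy
    have := hN.isProbabilityMeasure hV z
    have h1 := hN.sweep_mono hV hz (f := fun _ => φ x - ε / 8) (integrable_const _)
      (integrable_reduced (Ω := Ω) hN hφ hM hV z) (fun t ht => by
        have := abs_lt.1 (hosc t (frontier_subset_closure ht))
        linarith [le_reduced (Ω := Ω) hN hM t])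
    rw [hN.sweep_const hV] at h1
    have := abs_lt.1 (hosc z (subset_closure hz))
    linarith
  have hcont : ContinuousAt (sweep H V (reduced 𝒱 H Ω φ)) x :=
    (hN.strong_feller V hV _ (measurable_reduced hN hφ hM)
      ⟨M, abs_reduced_le hN hM⟩).continuousAt ((hN.isOpen hV).mem_nhds hxV)
  filter_upwards [(hN.isOpen hV).mem_nhds hxV,
    Metric.continuousAt_iff'.1 hcont (ε / 4) (by positivity)] with y hy hy2
  rw [Real.dist_eq, abs_lt] at hy2 ⊢
  have h1 := key y hy
  have h2 := key x hxV
  have h3 := sweep_reduced_le hN hφ hM hVΩ x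
  have h4 := sweep_reduced_le hN hφ hM hVΩ y
  constructor <;> linarith

end Reduced

end Bauer

end

/-! ### Harmonic functions, open components and the strict minimum principle. -/

noncomputable section

namespace Bauer

variable {X : Type*} [TopologicalSpace X]

theorem exists_bounded_continuous_extension [T2Space X] [NormalSpace X] {s : Set X}
    (hs : IsCompact s) {f : X → ℝ} (hf : ContinuousOn f s) :
    ∃ F : X → ℝ, Continuous F ∧ EqOn F f s ∧ ∃ C, ∀ x, |F x| ≤ C := by
  obtain ⟨G, hG⟩ := ContinuousMap.exists_restrict_eq hs.isClosed ⟨s.domRestrict f, hf.domRestrict⟩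
  obtain ⟨C, hC⟩ := hs.exists_bound_of_continuousOn hf
  have hGf : ∀ x ∈ s, G x = f x := fun x hx => DFunLike.congr_fun hG ⟨x, hx⟩
  refine ⟨fun x => max (-|C|) (min (G x) |C|), by fun_prop, fun x hx => ?_, |C|, fun x => ?_⟩
  · have h := abs_le.1 ((hC x hx).trans (le_abs_self C))
    simp only [hGf x hx]
    rw [min_eq_left h.2, max_eq_right h.1]
  · exact abs_le.2 ⟨le_max_left _ _, max_le (by linarith [abs_nonneg C]) (min_le_right _ _)⟩

theorem _root_.IsPreconnected.inter_frontier_nonempty_of_diff {s t : Set X} (hs : IsPreconnected s)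
    (h1 : (s ∩ t).Nonempty) (h2 : (s \ t).Nonempty) : (s ∩ frontier t).Nonempty := by
  by_contra hne
  have hne' : ∀ x ∈ s, x ∉ frontier t := fun x hx hxt => hne ⟨x, hx, hxt⟩
  obtain ⟨x, hxs, hxt⟩ := h1
  obtain ⟨y, hys, hyt⟩ := h2
  have hcov : ∀ z ∈ s, z ∈ interior t ∨ z ∉ closure t := fun z hz => by
    by_contra! h
    exact hne' z hz ⟨h.2, h.1⟩
  obtain ⟨z, -, hz1, hz2⟩ := hs (interior t) (closure t)ᶜ isOpen_interior
    isClosed_closure.isOpen_compl hcov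
    ⟨x, hxs, (hcov x hxs).resolve_right fun h => h (subset_closure hxt)⟩
    ⟨y, hys, (hcov y hys).resolve_left fun h => hyt (interior_subset h)⟩
  exact hz2 (subset_closure (interior_subset hz1))

variable [MeasurableSpace X] {𝒱 : Set (Set X)} {H : Set X → Kernel X X} {U V W O D : Set X}

theorem Harmonic.mono {h : X → ℝ} (hh : Harmonic 𝒱 H U h) (hVU : V ⊆ U) : Harmonic 𝒱 H V h :=
  ⟨hh.1.mono hVU, fun V' hV' => hh.2 V' (inside_mono hVU hV')⟩

theorem harmonic_sweep (hN : IsNormalBauerFamily 𝒱 H) (hV : V ∈ 𝒱) {f : X → ℝ}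
    (hf : Measurable f) {C : ℝ} (hC : ∀ x, |f x| ≤ C) : Harmonic 𝒱 H V (sweep H V f) :=
  ⟨hN.strong_feller V hV f hf ⟨C, hC⟩, fun _ hV' x _ =>
    hN.sweep_sweep hV hV'.1 (subset_closure.trans hV'.2) hf hC x⟩

theorem Harmonic.continuousOn_frontier {h : X → ℝ} (hh : Harmonic 𝒱 H U h)
    (hV : V ∈ inside 𝒱 U) : ContinuousOn h (frontier V) :=
  hh.1.mono (frontier_subset_closure.trans hV.2)

variable [T2Space X] [LocallyCompactSpace X] [SecondCountableTopology X] [BorelSpace X]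

theorem Harmonic.integrable {h : X → ℝ} (hh : Harmonic 𝒱 H U h) (hN : IsNormalBauerFamily 𝒱 H)
    (hV : V ∈ inside 𝒱 U) {x : X} (hx : x ∈ V) : Integrable h (H V x) :=
  hN.integrable_of_continuousOn hV.1 hx (hh.continuousOn_frontier hV)

theorem Harmonic.add {h k : X → ℝ} (hh : Harmonic 𝒱 H U h) (hk : Harmonic 𝒱 H U k)
    (hN : IsNormalBauerFamily 𝒱 H) : Harmonic 𝒱 H U fun x => h x + k x :=
  ⟨hh.1.add hk.1, fun V hV x hx =>
    (sweep_add (hh.integrable hN hV hx) (hk.integrable hN hV hx)).trans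
      (congrArg₂ _ (hh.2 V hV x hx) (hk.2 V hV x hx))⟩

theorem Harmonic.sub {h k : X → ℝ} (hh : Harmonic 𝒱 H U h) (hk : Harmonic 𝒱 H U k)
    (hN : IsNormalBauerFamily 𝒱 H) : Harmonic 𝒱 H U fun x => h x - k x :=
  ⟨hh.1.sub hk.1, fun V hV x hx =>
    (sweep_sub (hh.integrable hN hV hx) (hk.integrable hN hV hx)).trans
      (congrArg₂ _ (hh.2 V hV x hx) (hk.2 V hV x hx))⟩

theorem harmonic_const (hN : IsNormalBauerFamily 𝒱 H) (c : ℝ) : Harmonic 𝒱 H U fun _ => c :=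
  ⟨continuousOn_const, fun _ hV x _ => hN.sweep_const hV.1 c x⟩

/-- The Feller property concerns functions continuous on all of `X`; on `closure V`, `H_V f` depends
only on the values of `f` there, so `f` may be replaced by a continuous extension. -/
theorem continuousOn_sweep_closure (hN : IsNormalBauerFamily 𝒱 H) (hV : V ∈ 𝒱) {f : X → ℝ}
    (hf : ContinuousOn f (closure V)) : ContinuousOn (sweep H V f) (closure V) := by
  obtain ⟨F, hF, hFf, -⟩ := exists_bounded_continuous_extension (hN.compact_closure V hV) hf
  refine (hN.feller V hV F hF).continuousOn.congr fun x hx => ?_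
  by_cases hxV : x ∈ V
  · exact hN.sweep_congr hV hxV fun y hy => (hFf (frontier_subset_closure hy)).symm
  · exact ((hN.sweep_of_notMem hV hxV f).trans (hFf hx).symm).trans
      (hN.sweep_of_notMem hV hxV F).symm

/-- The mean value property is needed for just one `V` at each point, which suits functions only
known to be harmonic locally. -/
theorem nonneg_of_harmonic (hN : IsNormalBauerFamily 𝒱 H) (hW : IsPSet 𝒱 H W)
    (hUc : IsCompact (closure U)) (hUW : closure U ⊆ W) (hU : IsOpen U) {u : X → ℝ}
    (hu : ContinuousOn u (closure U)) (hb : ∀ z ∈ frontier U, 0 ≤ u z)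
    (hs : ∀ x ∈ U, ∃ V ∈ inside 𝒱 U, x ∈ V ∧ sweep H V u x = u x) :
    ∀ x ∈ closure U, 0 ≤ u x := by
  refine minimum_principle hN hW hUc hUW hU hu.lowerSemicontinuousOn hb fun x hx => ?_
  obtain ⟨V, hV, hxV, h⟩ := hs x hx
  exact ⟨V, hV, hxV, hN.integrable_of_continuousOn hV.1 hxV
    (hu.mono (frontier_subset_closure.trans (hV.2.trans subset_closure))), h.le⟩

theorem eqOn_zero_of_harmonic (hN : IsNormalBauerFamily 𝒱 H) (hW : IsPSet 𝒱 H W)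
    (hUc : IsCompact (closure U)) (hUW : closure U ⊆ W) (hU : IsOpen U) {u : X → ℝ}
    (hu : ContinuousOn u (closure U)) (hb : ∀ z ∈ frontier U, u z = 0)
    (hs : ∀ x ∈ U, ∃ V ∈ inside 𝒱 U, x ∈ V ∧ sweep H V u x = u x) :
    ∀ x ∈ closure U, u x = 0 := by
  intro x hx
  refine le_antisymm ?_ (nonneg_of_harmonic hN hW hUc hUW hU hu (fun z hz => (hb z hz).ge) hs x hx)
  refine neg_nonneg.1 (nonneg_of_harmonic (u := fun x => -u x) hN hW hUc hUW hU hu.neg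
    (fun z hz => by simp [hb z hz]) (fun y hy => ?_) x hx)
  obtain ⟨V, hV, hyV, h⟩ := hs y hy
  exact ⟨V, hV, hyV, by rw [sweep_neg, h]⟩

/-- Harmonic measures do not leave relatively clopen sets. -/
theorem ae_mem_of_clopen (hN : IsNormalBauerFamily 𝒱 H) (hW : IsPSet 𝒱 H W) (hOW : O ⊆ W)
    {A : Set X} (hA : IsOpen A) (hA' : IsOpen (O \ A)) (hV : V ∈ inside 𝒱 O) {x : X}
    (hxV : x ∈ V) (hxA : x ∈ A) : ∀ᵐ y ∂(H V x), y ∈ A := by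
  set i : X → ℝ := A.indicator 1 with hi
  have hVc := hN.compact_closure V hV.1
  have hs : IsClosed (closure V \ A) := isClosed_closure.inter hA.isClosed_compl
  have ht : IsClosed (closure V ∩ A) := by
    have : closure V ∩ A = closure V \ (O \ A) := by
      ext y
      have := @hV.2 y
      simp only [mem_inter_iff, mem_sdiff]
      tauto
    rw [this]
    exact isClosed_closure.inter hA'.isClosed_compl
  obtain ⟨f, hf0, hf1, hf⟩ := exists_continuous_zero_one_of_isClosed hs ht
    (disjoint_left.2 fun y h1 h2 => h1.2 h2.2)
  have hfi : EqOn f i (closure V) := by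
    intro y hy
    by_cases hyA : y ∈ A
    · simpa [hi, hyA] using hf1 ⟨hy, hyA⟩
    · simpa [hi, hyA] using hf0 ⟨hy, hyA⟩
  have hfb : ∀ y, |f y| ≤ 1 := fun y => abs_le.2 ⟨by linarith [(hf y).1], (hf y).2⟩
  have hic : ContinuousOn i (closure V) := f.continuous.continuousOn.congr hfi.symm
  have hsf : Continuous (sweep H V f) := hN.feller V hV.1 f f.continuous
  -- The indicator of `A` is locally constant on `O`, hence locally harmonic. By uniqueness it
  -- agrees with its own sweep on `V`.
  have hzero := eqOn_zero_of_harmonic (u := fun y => sweep H V f y - i y) hN hW hVc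
    (hV.2.trans hOW) (hN.isOpen hV.1) (hsf.continuousOn.sub hic) (by
      intro z hz
      have hz' := hz
      rw [(hN.isOpen hV.1).frontier_eq] at hz'
      rw [hN.sweep_of_notMem hV.1 hz'.2, hfi hz'.1, sub_self]) (by
      intro y hy
      have hyO : y ∈ O := hV.2 (subset_closure hy)
      have hloc : ∃ B : Set X, IsOpen B ∧ y ∈ B ∧ ∀ z ∈ B, i z = i y := by
        by_cases hyA : y ∈ A
        · exact ⟨A, hA, hyA, fun z hz => by simp [hi, hz, hyA]⟩
        · exact ⟨O \ A, hA', ⟨hyO, hyA⟩, fun z hz => by simp [hi, hz.2, hyA]⟩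
      obtain ⟨B, hB, hyB, hBi⟩ := hloc
      obtain ⟨V', hV', hyV', hcl⟩ := hN.exists_mem_closure_subset
        (((hN.isOpen hV.1).inter hB).mem_nhds ⟨hy, hyB⟩)
      have hclV : closure V' ⊆ V := hcl.trans inter_subset_left
      refine ⟨V', ⟨hV', hclV⟩, hyV', ?_⟩
      have h1 : Integrable (sweep H V f) (H V' y) :=
        hN.integrable_of_continuousOn hV' hyV' hsf.continuousOn
      have h2 : Integrable i (H V' y) := hN.integrable_of_continuousOn hV' hyV'
        (hic.mono (frontier_subset_closure.trans (hclV.trans subset_closure)))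
      rw [sweep_sub h1 h2, hN.sweep_sweep hV.1 hV' (subset_closure.trans hclV)
        f.continuous.measurable hfb, hN.sweep_congr hV' hyV' (g := fun _ => i y)
          (fun z hz => hBi z (hcl (frontier_subset_closure hz)).2), hN.sweep_const hV'])
    x (subset_closure hxV)
  have hone : sweep H V i x = 1 := by
    rw [← hN.sweep_congr hV.1 hxV (hfi.mono frontier_subset_closure), sub_eq_zero.1 hzero]
    simp [hi, hxA]
  have := hN.isProbabilityMeasure hV.1 x
  rw [sweep, hi, integral_indicator_one hA.measurableSet] at hone
  have : H V x A = 1 := by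
    rwa [measureReal_def, ENNReal.toReal_eq_one_iff] at hone
  exact (prob_compl_eq_zero_iff hA.measurableSet).2 this

/-- Open subsets of a `𝒫`-set have open components. -/
theorem exists_isOpen_isConnected (hN : IsNormalBauerFamily 𝒱 H) (hW : IsPSet 𝒱 H W)
    (hO : IsOpen O) (hOW : O ⊆ W) {x : X} (hx : x ∈ O) :
    ∃ Q, IsOpen Q ∧ IsConnected Q ∧ x ∈ Q ∧ Q ⊆ O ∧ IsOpen (O \ Q) := by
  -- `X` is not assumed locally connected. The quasi-component `Q` of `x` is shown to be open
  -- through its indicator, which is invariant under `H_V` and so continuous by the strong Feller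
  -- property.
  let 𝒜 : Set (Set X) := {A | x ∈ A ∧ A ⊆ O ∧ IsOpen A ∧ IsOpen (O \ A)}
  have hO𝒜 : O ∈ 𝒜 := ⟨hx, subset_rfl, hO, by simp⟩
  set Q := ⋂₀ 𝒜 with hQ
  have hxQ : x ∈ Q := fun A hA => hA.1
  have hQO : Q ⊆ O := sInter_subset_of_mem hO𝒜
  obtain ⟨T, hTc, hTs, hTU⟩ := TopologicalSpace.isOpen_sUnion_countable ((O \ ·) '' 𝒜) (by
    rintro _ ⟨A, hA, rfl⟩
    exact hA.2.2.2)
  have hOQ : O \ Q = ⋃₀ T := by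
    rw [hTU]
    ext y
    simp [hQ]
  have hOQo : IsOpen (O \ Q) := by
    rw [hOQ]
    refine isOpen_sUnion fun t ht => ?_
    obtain ⟨A, hA, rfl⟩ := hTs ht
    exact hA.2.2.2
  have hQm : MeasurableSet Q := by
    rw [← sdiff_sdiff_cancel_left hQO]
    exact hO.measurableSet.diff hOQo.measurableSet
  have hsw : ∀ V ∈ inside 𝒱 O, EqOn (sweep H V (Q.indicator 1)) (Q.indicator 1) V := by
    intro V hV y hy
    have hyO : y ∈ O := hV.2 (subset_closure hy)
    have hp := hN.isProbabilityMeasure hV.1 y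
    by_cases hyQ : y ∈ Q
    · have hae : ∀ᵐ z ∂(H V y), ∀ t ∈ T, z ∈ O \ t := by
        refine (ae_ball_iff hTc).2 fun t ht => ?_
        obtain ⟨A, hA, rfl⟩ := hTs ht
        simp only [sdiff_sdiff_cancel_left hA.2.1]
        exact ae_mem_of_clopen hN hW hOW hA.2.2.1 hA.2.2.2 hV hy (hyQ A hA)
      have hae' : ∀ᵐ z ∂(H V y), Q.indicator (1 : X → ℝ) z = 1 := by
        filter_upwards [hae, hN.ae_mem_frontier hV.1 hy] with z hz hzV
        have hzO : z ∈ O := hV.2 (frontier_subset_closure hzV)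
        have hzQ : z ∈ Q := by
          by_contra h
          have : z ∈ ⋃₀ T := hOQ ▸ ⟨hzO, h⟩
          obtain ⟨t, ht, hzt⟩ := this
          exact (hz t ht).2 hzt
        simp [hzQ]
      rw [sweep, integral_congr_ae hae']
      simp [hyQ]
    · have : y ∈ ⋃₀ T := hOQ ▸ ⟨hyO, hyQ⟩
      obtain ⟨t, ht, hyt⟩ := this
      obtain ⟨A, hA, rfl⟩ := hTs ht
      have hae := ae_mem_of_clopen hN hW hOW hA.2.2.2
        (by rw [sdiff_sdiff_cancel_left hA.2.1]; exact hA.2.2.1) hV hy hyt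
      have hae' : ∀ᵐ z ∂(H V y), Q.indicator (1 : X → ℝ) z = 0 := by
        filter_upwards [hae] with z hz
        exact indicator_of_notMem (fun h : z ∈ Q => hz.2 (h A hA)) _
      rw [sweep, integral_congr_ae hae']
      simp [hyQ]
  have hQo : IsOpen Q := by
    rw [isOpen_iff_mem_nhds]
    intro y hy
    obtain ⟨V, hV, hyV, hcl⟩ := hN.exists_mem_closure_subset (hO.mem_nhds (hQO hy))
    have hc : ContinuousOn (Q.indicator (1 : X → ℝ)) V :=
      (hN.strong_feller V hV _ (measurable_one.indicator hQm) ⟨1, fun z => by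
        by_cases hz : z ∈ Q <;> simp [hz]⟩).congr (hsw V ⟨hV, hcl⟩).symm
    have hca := hc.continuousAt ((hN.isOpen hV).mem_nhds hyV)
    have hpos : (0 : ℝ) < Q.indicator 1 y := by simp [hy]
    filter_upwards [hca.eventually (lt_mem_nhds hpos)] with z hz
    by_contra h
    simp [h] at hz
  refine ⟨Q, hQo, ⟨⟨x, hxQ⟩, ?_⟩, hxQ, hQO, hOQo⟩
  have key : ∀ u v : Set X, IsOpen u → IsOpen v → Q ⊆ u ∪ v → Q ∩ (u ∩ v) = ∅ → x ∈ u →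
      Q ⊆ u := by
    intro u v hu hv huv hd hxu
    have hmem : Q ∩ u ∈ 𝒜 := by
      refine ⟨⟨hxQ, hxu⟩, inter_subset_left.trans hQO, hQo.inter hu, ?_⟩
      have : O \ (Q ∩ u) = (O \ Q) ∪ (Q ∩ v) := by
        ext y
        have h1 := @huv y
        have h2 : ¬ (y ∈ Q ∩ (u ∩ v)) := by simp [hd]
        have h3 := @hQO y
        simp only [mem_sdiff, mem_inter_iff, mem_union] at *
        tauto
      rw [this]
      exact hOQo.union (hQo.inter hv)
    exact (sInter_subset_of_mem hmem).trans inter_subset_right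
  rw [isPreconnected_iff_subset_of_disjoint]
  intro u v hu hv huv hd
  rcases huv hxQ with h | h
  · exact Or.inl (key u v hu hv huv hd h)
  · exact Or.inr (key v u hv hu (union_comm u v ▸ huv) (inter_comm u v ▸ hd) h)

/-- The strict minimum principle for continuous superharmonic functions. -/
theorem IsElliptic.superharmonic_eq_zero_or_pos (hell : IsElliptic 𝒱 H)
    (hN : IsNormalBauerFamily 𝒱 H) (hW : IsPSet 𝒱 H W) (hD : IsOpen D) (hDc : IsConnected D)
    (hDW : D ⊆ W) {q : X → ℝ} (hq : ContinuousOn q D) (hq0 : ∀ x ∈ D, 0 ≤ q x)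
    (hsup : ∀ V ∈ inside 𝒱 D, ∀ x ∈ V, sweep H V q x ≤ q x) :
    (∀ x ∈ D, q x = 0) ∨ ∀ x ∈ D, 0 < q x := by
  by_contra! hcon
  obtain ⟨⟨y, hyD, hy⟩, ⟨x₀, hx₀D, hx₀⟩⟩ := hcon
  have hG : IsOpen (D ∩ q ⁻¹' Ioi 0) := hq.isOpen_inter_preimage hD isOpen_Ioi
  have hyG : y ∈ D ∩ q ⁻¹' Ioi 0 := ⟨hyD, lt_of_le_of_ne (hq0 y hyD) (Ne.symm hy)⟩
  -- `G'` is the component of `{q > 0}` containing `y`. Connectedness of `D` gives a point `x ∈ D`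
  -- of its boundary, where `q` must vanish.
  obtain ⟨G', hG'o, hG'c, hyG', hG'G, hGG'⟩ :=
    exists_isOpen_isConnected hN hW hG (inter_subset_left.trans hDW) hyG
  obtain ⟨x, hxD, hxf⟩ := hDc.isPreconnected.inter_frontier_nonempty_of_diff (t := G')
    ⟨y, hyD, hyG'⟩ ⟨x₀, hx₀D, fun h => not_lt.2 hx₀ (hG'G h).2⟩
  have hxcl : x ∈ closure G' := frontier_subset_closure hxf
  have hxG' : x ∉ G' := by
    rw [hG'o.frontier_eq] at hxf
    exact hxf.2
  have hqx : q x = 0 := by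
    by_contra hne
    have hxG : x ∈ (D ∩ q ⁻¹' Ioi 0) \ G' := ⟨⟨hxD, lt_of_le_of_ne (hq0 x hxD) (Ne.symm hne)⟩, hxG'⟩
    obtain ⟨z, hz1, hz2⟩ := mem_closure_iff.1 hxcl _ hGG' hxG
    exact hz1.2 hz2
  obtain ⟨V, hV, hxV, hcl⟩ := hN.exists_mem_closure_subset
    ((hD.sdiff isClosed_singleton).mem_nhds (⟨hxD, fun h => hxG' (h ▸ hyG')⟩ : x ∈ D \ {y}))
  have hVD : V ∈ inside 𝒱 D := ⟨hV, hcl.trans sdiff_subset⟩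
  have hVo := hN.isOpen hV
  obtain ⟨V', hV'o, hV'c, hxV', hV'V, hVV'⟩ :=
    exists_isOpen_isConnected hN hW hVo (subset_closure.trans (hVD.2.trans hDW)) hxV
  obtain ⟨z, hz1, hz2⟩ := mem_closure_iff.1 hxcl V' hV'o hxV'
  -- `G'` meets `V'` but contains `y` outside it, so it crosses `∂V'` at a point `w`; this `w` lies
  -- on `∂V` because `V \ V'` is open. Ellipticity on `V'` will force `H_V q = 0` there and, by
  -- continuity up to `w`, `q w = 0`.
  obtain ⟨w, hwG', hwf⟩ := hG'c.isPreconnected.inter_frontier_nonempty_of_diff (t := V')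
    ⟨z, hz2, hz1⟩ ⟨y, hyG', fun h => (hcl (subset_closure (hV'V h))).2 rfl⟩
  have hwcl : w ∈ closure V' := frontier_subset_closure hwf
  have hwV : w ∉ V := by
    intro hwV
    rw [hV'o.frontier_eq] at hwf
    obtain ⟨t, ht1, ht2⟩ := mem_closure_iff.1 hwcl _ hVV' ⟨hwV, hwf.2⟩
    exact ht1.2 ht2
  obtain ⟨F, hF, hFq, C, hFC⟩ := exists_bounded_continuous_extension (hN.compact_closure V hV)
    (hq.mono hVD.2)
  have hFV : ∀ y ∈ V, sweep H V F y = sweep H V q y := fun y hy =>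
    hN.sweep_congr hV hy (hFq.mono frontier_subset_closure)
  have hnn : ∀ y ∈ V, 0 ≤ sweep H V F y := by
    intro y hy
    rw [hFV y hy]
    refine integral_nonneg_of_ae ?_
    filter_upwards [hN.ae_mem_frontier hV hy] with t ht
    exact hq0 t (hVD.2 (frontier_subset_closure ht))
  have hFx : sweep H V F x = 0 :=
    le_antisymm (by rw [hFV x hxV, ← hqx]; exact hsup V hVD x hxV) (hnn x hxV)
  have hzero : ∀ y ∈ V', sweep H V F y = 0 := by
    refine (hell V' hV'o hV'c _ ((harmonic_sweep hN hV hF.measurable hFC).mono hV'V)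
      fun y hy => hnn y (hV'V hy)).resolve_right fun h => ?_
    exact (h x hxV').ne' hFx
  have hclz : closure V' ⊆ {y | sweep H V F y = 0} :=
    closure_minimal hzero (isClosed_eq (hN.feller V hV F hF) continuous_const)
  have hw0 : sweep H V F w = 0 := hclz hwcl
  rw [hN.sweep_of_notMem hV hwV, hFq (closure_mono hV'V hwcl)] at hw0
  exact (hG'G hwG').2.ne' hw0

end Bauer

end

/-! ### Potentials, and neighborhoods with barriers. -/

noncomputable section

namespace Bauer

variable {X : Type*} [TopologicalSpace X] [MeasurableSpace X] {𝒱 : Set (Set X)}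
  {H : Set X → Kernel X X} {U V W Ω : Set X} [T2Space X] [LocallyCompactSpace X]
  [SecondCountableTopology X] [BorelSpace X]

theorem reduced_nonneg (hN : IsNormalBauerFamily 𝒱 H) {φ : X → ℝ} {M : ℝ}
    (hM : ∀ x, |φ x| ≤ M) (h0 : ∀ x, 0 ≤ φ x) (x : X) : 0 ≤ reduced 𝒱 H Ω φ x :=
  (h0 x).trans (le_reduced hN hM x)

/-- Iterated sweeps stay below hyperharmonic majorants. -/
theorem IsIteratedSweep.ofReal_le (hN : IsNormalBauerFamily 𝒱 H) {φ g : X → ℝ} {M : ℝ}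
    (hg : IsIteratedSweep 𝒱 H Ω φ g) (hφ : Continuous φ) (hM : ∀ x, |φ x| ≤ M)
    (h0 : ∀ x, 0 ≤ φ x) {w : X → ENNReal}
    (hw : ∀ z ∈ Ω, ∀ V ∈ inside 𝒱 Ω, z ∈ V → ∫⁻ t, w t ∂(H V z) ≤ w z)
    (hφw : ∀ x ∈ Ω, ENNReal.ofReal (φ x) ≤ w x) :
    (∀ x, 0 ≤ g x) ∧ ∀ x ∈ Ω, ENNReal.ofReal (g x) ≤ w x := by
  induction hg with
  | base => exact ⟨h0, hφw⟩
  | sup _ _ h1 h2 =>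
    refine ⟨fun x => (h1.1 x).trans (le_max_left _ _), fun x hx => ?_⟩
    change ENNReal.ofReal (max _ _) ≤ _
    rw [ENNReal.ofReal_max]
    exact max_le (h1.2 x hx) (h2.2 x hx)
  | @sweep f V hV hf h =>
    refine ⟨fun x => integral_nonneg h.1, fun x hx => ?_⟩
    by_cases hxV : x ∈ V
    · rw [Bauer.sweep, ofReal_integral_eq_lintegral_ofReal (hN.integrable hV.1 x
        (hf.continuous hN hφ).measurable (hf.abs_apply_le hN hM)) (.of_forall h.1)]
      refine (lintegral_mono_ae ?_).trans (hw x hx V hV hxV)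
      filter_upwards [hN.ae_mem_frontier hV.1 hxV] with y hy
      exact h.2 y (hV.2 (frontier_subset_closure hy))
    · rw [hN.sweep_of_notMem hV.1 hxV]
      exact h.2 x hx

/-- Points of a `𝒫`-set are separated by reduced functions of bump functions. -/
theorem exists_reduced_lt (hN : IsNormalBauerFamily 𝒱 H) (hW : IsOpen W) {w : X → ENNReal}
    (hwl : LowerSemicontinuousOn w W)
    (hw : ∀ z ∈ W, ∀ V ∈ inside 𝒱 W, z ∈ V → ∫⁻ t, w t ∂(H V z) ≤ w z) {x y : X} (hx : x ∈ W)
    (hy : y ∈ W) (hxy : w y < w x) {N : Set X} (hNx : N ∈ 𝓝 x) :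
    ∃ (t : ℝ) (φ : X → ℝ) (C : Set X), 0 < t ∧ Continuous φ ∧ (∀ z, 0 ≤ φ z) ∧ (∀ z, φ z ≤ t) ∧
      IsCompact C ∧ C ⊆ N ∧ (∀ z ∉ C, φ z = 0) ∧ reduced 𝒱 H W φ x = t ∧
      reduced 𝒱 H W φ y < t := by
  -- A bump of height `r`, with `w y < r < w x`, supported in `{w > r}` lies below `w`. So does its
  -- reduced function, which is thus below `r` at `y` but equals `r` at `x`.
  obtain ⟨r, hr1, hr2⟩ := ENNReal.lt_iff_exists_nnreal_btwn.1 hxy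
  have hr0 : 0 < (r : ℝ) := NNReal.coe_pos.2 (ENNReal.coe_pos.1 (bot_le.trans_lt hr1))
  have hwx : {z | (r : ENNReal) < w z} ∈ 𝓝 x := by
    have h := hwl x hx r hr2
    rwa [hW.nhdsWithin_eq hx] at h
  obtain ⟨B, hB, hxB, hcl⟩ := hN.exists_mem_closure_subset (Filter.inter_mem hNx hwx)
  obtain ⟨ψ, hψ0, hψ1, hψ⟩ := exists_continuous_zero_one_of_isClosed
    (hN.isOpen hB).isClosed_compl (isClosed_singleton (x := x))
    (disjoint_singleton_right.2 fun h => h hxB)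
  have hφ : Continuous fun z => (r : ℝ) * ψ z := by fun_prop
  have hφ0 : ∀ z, 0 ≤ (r : ℝ) * ψ z := fun z => mul_nonneg hr0.le (hψ z).1
  have hφr : ∀ z, (r : ℝ) * ψ z ≤ r := fun z => mul_le_of_le_one_right hr0.le (hψ z).2
  have hφM : ∀ z, |(r : ℝ) * ψ z| ≤ r := fun z => by
    rw [abs_of_nonneg (hφ0 z)]
    exact hφr z
  have hφB : ∀ z ∉ closure B, (r : ℝ) * ψ z = 0 := fun z hz => by
    have : ψ z = 0 := hψ0 fun h => hz (subset_closure h)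
    rw [this, mul_zero]
  refine ⟨r, fun z => r * ψ z, closure B, hr0, hφ, hφ0, hφr, hN.compact_closure B hB,
    hcl.trans inter_subset_left, hφB, ?_, ?_⟩
  · refine le_antisymm (abs_le.1 (abs_reduced_le hN hφM x)).2 ?_
    refine le_trans ?_ (le_reduced hN hφM x)
    have : ψ x = 1 := hψ1 rfl
    rw [this, mul_one]
  · have hle : reduced 𝒱 H W (fun z => r * ψ z) y ≤ (w y).toReal := by
      refine reduced_le fun g hg => ?_
      refine (ENNReal.ofReal_le_iff_le_toReal (hr1.trans ENNReal.coe_lt_top).ne).1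
        ((hg.ofReal_le hN hφ hφM hφ0 hw fun z hz => ?_).2 y hy)
      by_cases hzB : z ∈ closure B
      · refine (ENNReal.ofReal_le_ofReal (hφr z)).trans ?_
        rw [ENNReal.ofReal_coe_nnreal]
        exact (hcl hzB).2.le
      · simp [hφB z hzB]
    refine hle.trans_lt ?_
    rw [← ENNReal.coe_toReal r]
    exact ENNReal.toReal_strict_mono ENNReal.coe_ne_top hr1

/-- Arbitrarily small neighborhoods `V` of `z` carry a function vanishing on `∂V` and harmonic off
a compact set `C` which is strictly larger than some `a > 0` on `C` and at `z`. -/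
theorem exists_potential (hN : IsNormalBauerFamily 𝒱 H) (hell : IsElliptic 𝒱 H)
    (hW : IsPSet 𝒱 H W) {z : X} (hz : z ∈ W) {N : Set X} (hNz : N ∈ 𝓝 z) :
    ∃ V ∈ inside 𝒱 W, z ∈ V ∧ closure V ⊆ N ∧ ∃ (q : X → ℝ) (C : Set X) (a : ℝ), 0 < a ∧
      IsCompact C ∧ ContinuousOn q (closure V) ∧ (∀ y ∈ frontier V, q y = 0) ∧
      Harmonic 𝒱 H (V \ C) q ∧ ∀ y ∈ insert z C, a < q y := by
  obtain ⟨V, hV𝒱, hzV, hcl⟩ := hN.exists_mem_closure_subset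
    (Filter.inter_mem hNz (hW.1.mem_nhds hz))
  have hV : V ∈ inside 𝒱 W := ⟨hV𝒱, hcl.trans inter_subset_right⟩
  have hVo := hN.isOpen hV𝒱
  have hVW : V ⊆ W := subset_closure.trans hV.2
  obtain ⟨D, hDo, hDc, hzD, hDV, -⟩ := exists_isOpen_isConnected hN hW hVo hVW hzV
  have hDW : D ⊆ W := hDV.trans hVW
  obtain ⟨V₁, hV₁, hzV₁, hcl₁⟩ := hN.exists_mem_closure_subset (hDo.mem_nhds hzD)
  -- A second point of `D` is needed, and `∂V₁` supplies one because it carries a probability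
  -- measure.
  obtain ⟨y, hy⟩ := hN.frontier_nonempty hV₁ hzV₁
  have hyD : y ∈ D := hcl₁ (frontier_subset_closure hy)
  have hyz : y ≠ z := by
    rintro rfl
    rw [(hN.isOpen hV₁).frontier_eq] at hy
    exact hy.2 hzV₁
  obtain ⟨w, hwl, hw, hne⟩ := hW.exists_ennreal hN (hDW hyD) hz hyz
  have hex : ∃ x₁ ∈ D, ∃ x₂ ∈ D, w x₂ < w x₁ := by
    rcases lt_or_gt_of_ne hne with h | h
    · exact ⟨z, hzD, y, hyD, h⟩
    · exact ⟨y, hyD, z, hzD, h⟩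
  obtain ⟨x₁, hx₁, x₂, hx₂, h12⟩ := hex
  obtain ⟨t, φ, C, ht, hφ, hφ0, hφt, hC, hCD, hφC, hpx₁, hpx₂⟩ :=
    exists_reduced_lt hN hW.1 hwl hw (hDW hx₁) (hDW hx₂) h12 (hDo.mem_nhds hx₁)
  have hM : ∀ x, |φ x| ≤ t := fun x => by
    rw [abs_of_nonneg (hφ0 x)]
    exact hφt x
  set p := reduced 𝒱 H W φ with hp
  have hpc : ContinuousOn p W := continuousOn_reduced hN hW hW.1 subset_rfl hφ hM
  have hpm : Measurable p := measurable_reduced hN hφ hM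
  have hpb : ∀ x, |p x| ≤ t := abs_reduced_le hN hM
  have hsm : Measurable (sweep H V p) := measurable_sweep hpm
  have hsb : ∀ x, |sweep H V p x| ≤ t := hN.abs_sweep_le hV𝒱 hpb
  have hqc : ContinuousOn (fun x => p x - sweep H V p x) (closure V) :=
    (hpc.mono hV.2).sub (continuousOn_sweep_closure hN hV𝒱 (hpc.mono hV.2))
  have hsp : Harmonic 𝒱 H V (sweep H V p) := harmonic_sweep hN hV𝒱 hpm hpb
  have hsq : ∀ V' ∈ inside 𝒱 V, ∀ x ∈ V',
      sweep H V' (fun x => p x - sweep H V p x) x = sweep H V' p x - sweep H V p x := by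
    intro V' hV' x hx
    rw [sweep_sub (hN.integrable hV'.1 x hpm hpb) (hN.integrable hV'.1 x hsm hsb),
      hN.sweep_sweep hV𝒱 hV'.1 (subset_closure.trans hV'.2) hpm hpb]
  -- If `p - H_V p` vanished on `D`, then `t - p` would be a positive harmonic function on `D`, zero
  -- at `x₁` and nonzero at `x₂`, against ellipticity.
  have hpos : ∀ x ∈ D, 0 < p x - sweep H V p x := by
    refine (hell.superharmonic_eq_zero_or_pos hN hW hDo hDc hDW
      (hqc.mono (hDV.trans subset_closure))
      (fun x _ => sub_nonneg.2 (sweep_reduced_le hN hφ hM hV x)) (fun V' hV' x hx => ?_)).resolve_left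
      fun h => ?_
    · rw [hsq V' (inside_mono hDV hV') x hx]
      exact sub_le_sub_right (sweep_reduced_le hN hφ hM (inside_mono hDW hV') x) _
    · rcases hell D hDo hDc (fun x => t - sweep H V p x)
        (((harmonic_const hN t).sub hsp hN).mono hDV)
        (fun x _ => sub_nonneg.2 (abs_le.1 (hsb x)).2) with h' | h'
      · linarith [h x₂ hx₂, h' x₂ hx₂]
      · linarith [h x₁ hx₁, h' x₁ hx₁]
  obtain ⟨b, hbC, hb⟩ := (hC.insert z).exists_isMinOn (insert_nonempty z C)
    (hqc.mono ((insert_subset hzD hCD).trans (hDV.trans subset_closure)))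
  have hb0 := hpos b (insert_subset hzD hCD hbC)
  refine ⟨V, hV, hzV, hcl.trans inter_subset_left, fun x => p x - sweep H V p x, C,
    (p b - sweep H V p b) / 2, half_pos hb0, hC, hqc, fun y hy => ?_,
    ⟨hqc.mono (sdiff_subset.trans subset_closure), fun V' hV' x hx => ?_⟩,
    fun y hy => (half_lt_self hb0).trans_le (hb hy)⟩
  · rw [hVo.frontier_eq] at hy
    change p y - sweep H V p y = 0
    rw [hN.sweep_of_notMem hV𝒱 hy.2, sub_self]
  · have hV'V := inside_mono (𝒱 := 𝒱) (sdiff_subset (s := V) (t := C)) hV'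
    refine (hsq V' hV'V x hx).trans ?_
    rw [sweep_reduced_eq hN hW hW.1 subset_rfl hφ hM (inside_mono hVW hV'V) (fun y hy => ?_) hx]
    rw [hφC y (hV'.2 (subset_closure hy)).2]
    exact integral_nonneg (reduced_nonneg hN hM hφ0)

/-- Every boundary point of `U` has a barrier: a harmonic function near the point which vanishes
there and is strictly positive on `U`. -/
def HasBarriers (𝒱 : Set (Set X)) (H : Set X → Kernel X X) (U : Set X) : Prop :=
  ∀ z ∈ frontier U, ∃ (N : Set X) (h : X → ℝ), IsOpen N ∧ z ∈ N ∧ Harmonic 𝒱 H N h ∧ h z = 0 ∧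
    ∀ x ∈ U ∩ N, 0 < h x

/-- Every compact set in a `𝒫`-set has a relatively compact open neighborhood with barriers. -/
theorem exists_isOpen_hasBarriers (hN : IsNormalBauerFamily 𝒱 H) (hell : IsElliptic 𝒱 H)
    (hW : IsPSet 𝒱 H W) {K : Set X} (hK : IsCompact K) (hKW : K ⊆ W) :
    ∃ U, IsOpen U ∧ IsCompact (closure U) ∧ K ⊆ U ∧ closure U ⊆ W ∧ HasBarriers 𝒱 H U := by
  obtain ⟨G, hG, hKG, hGW, hGc⟩ := exists_open_between_and_isCompact_closure hK hW.1 hKW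
  have hfc : IsCompact (frontier G) := hGc.of_isClosed_subset isClosed_frontier
    frontier_subset_closure
  have hloc : ∀ z ∈ frontier G, ∃ V ∈ inside 𝒱 W, z ∈ V ∧ closure V ⊆ Kᶜ ∧
      ∃ (q : X → ℝ) (C : Set X) (a : ℝ), 0 < a ∧
      IsCompact C ∧ ContinuousOn q (closure V) ∧ (∀ y ∈ frontier V, q y = 0) ∧
      Harmonic 𝒱 H (V \ C) q ∧ ∀ y ∈ insert z C, a < q y := by
    intro z hz
    have hzK : z ∉ K := fun h => by
      rw [hG.frontier_eq] at hz
      exact hz.2 (hKG h)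
    exact exists_potential hN hell hW (hGW (frontier_subset_closure hz))
      (hK.isClosed.isOpen_compl.mem_nhds hzK)
  choose! V hVW hzV hVK q C a ha hC hqc hq0 hqh hqa using hloc
  -- Since `q z` vanishes on `∂(V z)` and `a z > 0`, this closed set stays inside `V z`. It misses
  -- `K` because `closure (V z)` does.
  let B : X → Set X := fun z => closure (V z) ∩ q z ⁻¹' Ici (a z)
  have hBc : ∀ z ∈ frontier G, IsClosed (B z) := fun z hz =>
    (hqc z hz).preimage_isClosed_of_isClosed isClosed_closure isClosed_Ici
  have hVo : ∀ z ∈ frontier G, IsOpen (V z) := fun z hz => hN.isOpen (hVW z hz).1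
  have hBV : ∀ z ∈ frontier G, B z ⊆ V z := by
    rintro z hz y ⟨hy, hya⟩
    by_contra hyV
    have := hq0 z hz y (by rw [(hVo z hz).frontier_eq]; exact ⟨hy, hyV⟩)
    exact absurd (mem_Ici.1 (show q z y ∈ Ici (a z) from hya)) (by linarith [ha z hz])
  have hI : ∀ z ∈ frontier G, IsOpen (V z ∩ q z ⁻¹' Ioi (a z)) := fun z hz =>
    ((hqc z hz).mono subset_closure).isOpen_inter_preimage (hVo z hz) isOpen_Ioi
  have hIB : ∀ z, V z ∩ q z ⁻¹' Ioi (a z) ⊆ B z := fun z =>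
    inter_subset_inter subset_closure (preimage_mono Ioi_subset_Ici_self)
  obtain ⟨T, hTf, hTcov⟩ := hfc.elim_nhds_subcover (fun z => V z ∩ q z ⁻¹' Ioi (a z))
    fun z hz => (hI z hz).mem_nhds ⟨hzV z hz, hqa z hz z (mem_insert z _)⟩
  have hTc : IsClosed (⋃ z ∈ T, B z) :=
    T.finite_toSet.isClosed_biUnion fun z hz => hBc z (hTf z hz)
  have hUo : IsOpen (G \ ⋃ z ∈ T, B z) := hG.sdiff hTc
  have hUG : closure (G \ ⋃ z ∈ T, B z) ⊆ closure G := closure_mono sdiff_subset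
  refine ⟨G \ ⋃ z ∈ T, B z, hUo, hGc.of_isClosed_subset isClosed_closure hUG, ?_,
    hUG.trans hGW, ?_⟩
  · intro x hx
    refine ⟨hKG hx, fun h => ?_⟩
    obtain ⟨z, hzT, hxz⟩ := mem_iUnion₂.1 h
    exact hVK z (hTf z hzT) hxz.1 hx
  · intro y hy
    have hycl := frontier_subset_closure hy
    rw [hUo.frontier_eq] at hy
    have hdisj : ∀ z ∈ T, y ∉ V z ∩ q z ⁻¹' Ioi (a z) := by
      intro z hzT hyI
      obtain ⟨x, hx1, hx2⟩ := mem_closure_iff.1 hycl _ (hI z (hTf z hzT)) hyI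
      exact hx2.2 (mem_iUnion₂.2 ⟨z, hzT, hIB z hx1⟩)
    have hyG : y ∈ G := by
      by_contra hyG
      have : y ∈ frontier G := by
        rw [hG.frontier_eq]
        exact ⟨hUG hycl, hyG⟩
      obtain ⟨z, hzT, hyI⟩ := mem_iUnion₂.1 (hTcov this)
      exact hdisj z hzT hyI
    have hyB : y ∈ ⋃ z ∈ T, B z := by
      by_contra h
      exact hy.2 ⟨hyG, h⟩
    obtain ⟨z, hzT, hyz⟩ := mem_iUnion₂.1 hyB
    have hz := hTf z hzT
    have hyV := hBV z hz hyz
    have hqy : q z y = a z := by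
      refine le_antisymm (not_lt.1 fun h => hdisj z hzT ⟨hyV, h⟩) hyz.2
    -- On `C z` one has `q z > a z`, so the boundary point `y`, where `q z y = a z`, avoids `C z`.
    -- Points of `U` in `V z` lie outside `B z`, which makes the barrier positive.
    refine ⟨V z \ C z, fun x => a z - q z x, (hVo z hz).sdiff (hC z hz).isClosed,
      ⟨hyV, fun h => (hqa z hz y (mem_insert_of_mem z h)).ne' hqy⟩,
      (harmonic_const hN _).sub (hqh z hz) hN, sub_eq_zero.2 hqy.symm, ?_⟩
    rintro x ⟨hxU, hxN⟩
    rw [sub_pos]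
    by_contra! h
    exact hxU.2 (mem_iUnion₂.2 ⟨z, hzT, subset_closure hxN.1, h⟩)

end Bauer

end

/-! ### Boundary behavior of reduced functions and the Dirichlet problem. -/

noncomputable section

namespace Bauer

variable {X : Type*} [TopologicalSpace X] [MeasurableSpace X] {𝒱 : Set (Set X)}
  {H : Set X → Kernel X X} {U V W Ω : Set X} [T2Space X] [LocallyCompactSpace X]
  [SecondCountableTopology X] [BorelSpace X]

theorem Harmonic.const_mul {h : X → ℝ} (hh : Harmonic 𝒱 H U h) (c : ℝ) :
    Harmonic 𝒱 H U fun x => c * h x :=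
  ⟨continuousOn_const.mul hh.1, fun V hV x hx =>
    (sweep_const_mul x c h).trans (congrArg (c * ·) (hh.2 V hV x hx))⟩

theorem Harmonic.congr {h k : X → ℝ} (hh : Harmonic 𝒱 H U h) (hN : IsNormalBauerFamily 𝒱 H)
    (hk : EqOn k h U) : Harmonic 𝒱 H U k :=
  ⟨hh.1.congr hk, fun V hV x hx =>
    (hN.sweep_congr hV.1 hx (hk.mono (frontier_subset_closure.trans hV.2))).trans
      ((hh.2 V hV x hx).trans (hk (hV.2 (subset_closure hx))).symm)⟩

theorem Harmonic.nonneg {h : X → ℝ} (hh : Harmonic 𝒱 H U h) (hN : IsNormalBauerFamily 𝒱 H)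
    (hW : IsPSet 𝒱 H W) (hUc : IsCompact (closure U)) (hUW : closure U ⊆ W) (hU : IsOpen U)
    (hc : ContinuousOn h (closure U)) (hb : ∀ z ∈ frontier U, 0 ≤ h z) :
    ∀ x ∈ closure U, 0 ≤ h x :=
  nonneg_of_harmonic hN hW hUc hUW hU hc hb fun x hx => by
    obtain ⟨V, hV, hxV, hcl⟩ := hN.exists_mem_closure_subset (hU.mem_nhds hx)
    exact ⟨V, ⟨hV, hcl⟩, hxV, hh.2 V ⟨hV, hcl⟩ x hxV⟩

/-- A harmonic function near `z` which vanishes at `z` and is strictly positive on `U` forces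
reduced functions in `U` to be small near `z`. -/
theorem eventually_reduced_le (hN : IsNormalBauerFamily 𝒱 H) (hW : IsPSet 𝒱 H W)
    (hU : IsOpen U) (hUW : U ⊆ W) {φ : X → ℝ} (hφ : Continuous φ) {M : ℝ}
    (hM : ∀ x, |φ x| ≤ M) {z : X} {N : Set X} {h : X → ℝ} (hNo : IsOpen N) (hzN : z ∈ N)
    (hh : Harmonic 𝒱 H N h) (hz : h z = 0) (hpos : ∀ x ∈ U ∩ N, 0 < h x) {ε : ℝ} (hε : 0 < ε) :
    ∀ᶠ x in 𝓝[U] z, reduced 𝒱 H U φ x < φ z + ε := by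
  have hM0 : 0 ≤ M := (abs_nonneg _).trans (hM z)
  obtain ⟨V, hV, hzV, hcl⟩ := hN.exists_mem_closure_subset (Filter.inter_mem (hNo.mem_nhds hzN)
    (hφ.continuousAt.preimage_mem_nhds (Metric.ball_mem_nhds (φ z) (half_pos hε))))
  have hVo := hN.isOpen hV
  have hVN : closure V ⊆ N := hcl.trans inter_subset_left
  have hφV : ∀ x ∈ V, φ x ≤ φ z + ε / 2 := fun x hx => by
    have h1 : |φ x - φ z| < ε / 2 := by
      simpa [Real.dist_eq] using (hcl (subset_closure hx)).2
    linarith [(abs_lt.1 h1).2]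
  obtain ⟨F, hF, hFh, C, hFC⟩ := exists_bounded_continuous_extension (hN.compact_closure V hV)
    (hh.1.mono hVN)
  -- The barrier may come arbitrarily close to zero on `U ∩ ∂V`, so no multiple of it need dominate
  -- there. The bad sets `∂V ∩ O n`, where `h` is small, decrease to the empty set, so their
  -- harmonic measure at `z` tends to zero.
  let O : ℕ → Set X := fun n => U ∩ (N ∩ h ⁻¹' Iio (1 / ((n : ℝ) + 1)))
  have hO : ∀ n, IsOpen (O n) := fun n =>
    hU.inter (hh.1.isOpen_inter_preimage hNo isOpen_Iio)
  let i : ℕ → X → ℝ := fun n => (frontier V ∩ O n).indicator 1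
  have him : ∀ n, Measurable (i n) := fun n => measurable_one.indicator
    (isClosed_frontier.measurableSet.inter (hO n).measurableSet)
  have hi0 : ∀ n x, 0 ≤ i n x := fun n x => indicator_nonneg (fun _ _ => zero_le_one) x
  have hib : ∀ n x, |i n x| ≤ 1 := fun n x => by
    by_cases hx : x ∈ frontier V ∩ O n
    · simp [i, indicator_of_mem hx]
    · simp [i, indicator_of_notMem hx]
  have hilim : ∀ x, Filter.Tendsto (fun n => i n x) Filter.atTop (𝓝 0) := by
    intro x
    refine tendsto_const_nhds.congr' ?_
    by_cases hx : x ∈ U ∩ N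
    · filter_upwards [tendsto_one_div_add_atTop_nhds_zero_nat.eventually
        (gt_mem_nhds (hpos x hx))] with n hn
      exact (indicator_of_notMem (fun hx' : x ∈ frontier V ∩ O n =>
        lt_asymm hn hx'.2.2.2) _).symm
    · exact .of_forall fun n => (indicator_of_notMem (fun hx' : x ∈ frontier V ∩ O n =>
        hx ⟨hx'.2.1, hx'.2.2.1⟩) _).symm
  have hslim := hN.tendsto_sweep hV him hib hilim z
  rw [hN.sweep_const hV] at hslim
  obtain ⟨n, hn⟩ := (hslim.eventually (gt_mem_nhds
    (by positivity : 0 < ε / (8 * (M + 1))))).exists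
  set c : ℝ := (n : ℝ) + 1 with hc
  have hc0 : 0 < c := by positivity
  set S := sweep H V (i n) with hS
  have hS0 : ∀ x, 0 ≤ S x := fun x => integral_nonneg (hi0 n)
  have hF0 : ∀ x ∈ U ∩ V, 0 < F x := fun x hx => by
    rw [hFh (subset_closure hx.2)]
    exact hpos x ⟨hx.1, hVN (subset_closure hx.2)⟩
  -- `c F` is at least 1 on the good part of `U ∩ ∂V`, and `S`, the harmonic measure of the bad
  -- part, takes over on the rest. The factor `2M` lifts `φ z ≥ -M` to at least `M`.
  let e : X → ℝ := fun x => (φ z + ε / 2) + 2 * M * (c * F x + S x)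
  have heh : Harmonic 𝒱 H V e :=
    (harmonic_const hN _).add (((((hh.mono (subset_closure.trans hVN)).congr hN
      (hFh.mono subset_closure)).const_mul c).add
        (harmonic_sweep hN hV (him n) (hib n)) hN).const_mul (2 * M)) hN
  have hem : Measurable e := by
    have h1 : Measurable F := hF.measurable
    have h2 : Measurable S := measurable_sweep (him n)
    fun_prop
  have hephi : ∀ x ∈ U ∩ V, φ z + ε / 2 ≤ e x := fun x hx =>
    le_add_of_nonneg_right (mul_nonneg (by positivity)
      (add_nonneg (mul_nonneg hc0.le (hF0 x hx).le) (hS0 x)))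
  classical
  -- The cutoff at `M` glues `e` to the constant `M` across `U ∩ ∂V`. Lower semicontinuity at these
  -- points is the only delicate property.
  let s : X → ℝ := fun x => if x ∈ U ∩ V then min M (e x) else M
  have hs_in : ∀ x ∈ U ∩ V, s x = min M (e x) := fun x hx => if_pos hx
  have hsM : ∀ x, s x ≤ M := fun x => by
    by_cases hx : x ∈ U ∩ V
    · simpa only [s, if_pos hx] using min_le_left _ _
    · simp only [s, if_neg hx, le_refl]
  have hse : ∀ x ∈ U ∩ V, s x ≤ e x := fun x hx => by
    simpa only [s, if_pos hx] using min_le_right _ _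
  have hsm : Measurable s := Measurable.ite (hU.inter hVo).measurableSet
    (measurable_const.min hem) measurable_const
  have hsb : ∀ x, |s x| ≤ M := fun x => by
    refine abs_le.2 ⟨?_, hsM x⟩
    by_cases hx : x ∈ U ∩ V
    · simp only [s, if_pos hx]
      have := (abs_le.1 (hM z)).1
      exact le_min (by linarith) (by linarith [hephi x hx])
    · simp only [s, if_neg hx]
      linarith
  have hs : LocallySuperharmonic 𝒱 H U s := by
    refine ⟨hsm, ⟨M, hsb⟩, ?_, ?_⟩
    · intro x hx y hy
      by_cases hxV : x ∈ V
      · have hca : ContinuousAt (fun x => min M (e x)) x :=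
          continuousAt_const.min (heh.1.continuousAt (hVo.mem_nhds hxV))
        rw [hs_in x ⟨hx, hxV⟩] at hy
        refine Filter.Eventually.filter_mono nhdsWithin_le_nhds ?_
        filter_upwards [hca.eventually (lt_mem_nhds hy),
          (hU.inter hVo).mem_nhds ⟨hx, hxV⟩] with t ht htm
        simpa only [s, if_pos htm] using ht
      · simp only [s, if_neg (fun h : x ∈ U ∩ V => hxV h.2)] at hy
        by_cases hxcl : x ∈ closure V
        · have hxf : x ∈ frontier V := by
            rw [hVo.frontier_eq]
            exact ⟨hxcl, hxV⟩
          -- A continuous minorant of `c F + S` that is at least 1 at `x`: either `c F` itself or,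
          -- since `O n` is open, the sweep of a bump below the indicator of `O n`, continuous by
          -- the Feller property.
          have hk : ∃ k : X → ℝ, Continuous k ∧ 1 ≤ k x ∧
              ∀ t ∈ U ∩ V, k t ≤ c * F t + S t := by
            by_cases hhx : 1 ≤ c * F x
            · exact ⟨fun t => c * F t, by fun_prop, hhx, fun t _ =>
                le_add_of_nonneg_right (hS0 t)⟩
            · have hxO : x ∈ O n := by
                refine ⟨hx, hVN hxcl, ?_⟩
                rw [mem_preimage, ← hFh hxcl, mem_Iio, lt_div_iff₀ hc0, mul_comm]
                exact not_le.1 hhx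
              obtain ⟨θ, hθ0, hθ1, hθ⟩ := exists_continuous_zero_one_of_isClosed
                (hO n).isClosed_compl (isClosed_singleton (x := x))
                (disjoint_singleton_right.2 fun h => h hxO)
              refine ⟨sweep H V θ, hN.feller V hV θ θ.continuous, ?_, fun t ht => ?_⟩
              · rw [hN.sweep_of_notMem hV hxV]
                exact (hθ1 rfl).ge
              · have h1 : sweep H V θ t ≤ S t := by
                  refine hN.sweep_mono hV ht.2 (hN.integrable hV t θ.continuous.measurable
                    (C := 1) fun y => ?_) (hN.integrable hV t (him n) (hib n)) fun y hy => ?_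
                  · exact abs_le.2 ⟨by linarith [(hθ y).1], (hθ y).2⟩
                  · by_cases hyO : y ∈ O n
                    · have : i n y = 1 := indicator_of_mem (s := frontier V ∩ O n) ⟨hy, hyO⟩ _
                      exact (hθ y).2.trans this.ge
                    · have : θ y = 0 := hθ0 hyO
                      rw [this]
                      exact hi0 n y
                have h2 := mul_nonneg hc0.le (hF0 t ht).le
                linarith
          obtain ⟨k, hkc, hk1, hk⟩ := hk
          have hkM : y < (φ z + ε / 2) + 2 * M * k x := by
            have := (abs_le.1 (hM z)).1
            have := mul_le_mul_of_nonneg_left hk1 (by positivity : 0 ≤ 2 * M)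
            linarith
          have hkc' : Continuous fun t => (φ z + ε / 2) + 2 * M * k t := by fun_prop
          refine Filter.Eventually.filter_mono nhdsWithin_le_nhds ?_
          filter_upwards [hkc'.continuousAt.eventually (lt_mem_nhds hkM)] with t ht
          by_cases htm : t ∈ U ∩ V
          · simp only [s, if_pos htm]
            refine lt_min hy (ht.trans_le ?_)
            exact add_le_add_right (mul_le_mul_of_nonneg_left (hk t htm) (by positivity)) _
          · simpa only [s, if_neg htm] using hy
        · refine Filter.Eventually.filter_mono nhdsWithin_le_nhds ?_
          filter_upwards [isClosed_closure.isOpen_compl.mem_nhds hxcl] with t ht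
          simpa only [s, if_neg (fun h : t ∈ U ∩ V => ht (subset_closure h.2))] using hy
    · intro x hx B hB
      have hconst : ∀ V' ∈ 𝒱, sweep H V' s x ≤ M := fun V' hV' => by
        have := hN.isProbabilityMeasure hV' x
        exact (integral_mono (hN.integrable hV' x hsm hsb) (integrable_const M) hsM).trans
          (hN.sweep_const hV' M x).le
      by_cases hxV : x ∈ V
      · obtain ⟨V', hV', hxV', hcl'⟩ := hN.exists_mem_closure_subset
          (Filter.inter_mem hB ((hU.inter hVo).mem_nhds ⟨hx, hxV⟩))
        have hUV' : closure V' ⊆ U ∩ V := hcl'.trans inter_subset_right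
        have hV'V : V' ∈ inside 𝒱 V := ⟨hV', hUV'.trans inter_subset_right⟩
        refine ⟨V', hV', hxV', hcl'.trans inter_subset_left, ?_⟩
        rw [hs_in x ⟨hx, hxV⟩]
        refine le_min (hconst V' hV') ?_
        exact (hN.sweep_mono hV' hxV' (hN.integrable hV' x hsm hsb) (heh.integrable hN hV'V hxV')
          fun y hy => hse y (hUV' (frontier_subset_closure hy))).trans (heh.2 V' hV'V x hxV').le
      · obtain ⟨V', hV', hxV', hcl'⟩ := hN.exists_mem_closure_subset hB
        refine ⟨V', hV', hxV', hcl', ?_⟩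
        simp only [s, if_neg (fun h : x ∈ U ∩ V => hxV h.2)]
        exact hconst V' hV'
  have hφs : ∀ x ∈ U, φ x ≤ s x := fun x hx => by
    have hφM := (abs_le.1 (hM x)).2
    by_cases hxV : x ∈ U ∩ V
    · simp only [s, if_pos hxV]
      exact le_min hφM ((hφV x hxV.2).trans (hephi x hxV))
    · simpa only [s, if_neg hxV] using hφM
  have hez : e z < φ z + ε := by
    have h1 : F z = 0 := (hFh (subset_closure hzV)).trans hz
    have h2 : 2 * M * S z ≤ 2 * M * (ε / (8 * (M + 1))) :=
      mul_le_mul_of_nonneg_left hn.le (by positivity)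
    have h3 : 2 * M * (ε / (8 * (M + 1))) < ε / 2 := by
      rw [mul_div_assoc', div_lt_iff₀ (by positivity)]
      nlinarith
    simp only [e, h1, mul_zero, zero_add]
    linarith
  have hec : ContinuousAt e z := heh.1.continuousAt (hVo.mem_nhds hzV)
  filter_upwards [self_mem_nhdsWithin, nhdsWithin_le_nhds (hVo.mem_nhds hzV),
    nhdsWithin_le_nhds (hec.eventually (gt_mem_nhds hez))] with x hxU hxV hx
  exact ((reduced_le_of_locallySuperharmonic hN hW hUW hφ hM hs hφs hxU).trans
    (hse x ⟨hxU, hxV⟩)).trans_lt hx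

theorem continuousAt_reduced_of_barrier (hN : IsNormalBauerFamily 𝒱 H) (hW : IsPSet 𝒱 H W)
    (hU : IsOpen U) (hUW : U ⊆ W) {φ : X → ℝ} (hφ : Continuous φ) {M : ℝ}
    (hM : ∀ x, |φ x| ≤ M) {z : X} (hzU : z ∉ U) {N : Set X} {h : X → ℝ} (hNo : IsOpen N)
    (hzN : z ∈ N) (hh : Harmonic 𝒱 H N h) (hz : h z = 0) (hpos : ∀ x ∈ U ∩ N, 0 < h x) :
    ContinuousAt (reduced 𝒱 H U φ) z := by
  rw [Metric.continuousAt_iff']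
  intro ε hε
  filter_upwards [eventually_nhdsWithin_iff.1
    (eventually_reduced_le hN hW hU hUW hφ hM hNo hzN hh hz hpos hε),
    Metric.continuousAt_iff'.1 hφ.continuousAt ε hε] with x h1 h2
  rw [reduced_eq_of_notMem hN hM hzU]
  by_cases hxU : x ∈ U
  · rw [Real.dist_eq, abs_lt] at h2 ⊢
    have h3 := le_reduced (Ω := U) hN hM x
    have h4 := h1 hxU
    constructor <;> linarith
  · rwa [reduced_eq_of_notMem hN hM hxU]

/-- The Dirichlet problem on `U` with boundary values `f` has a solution. -/
def IsSolvable (𝒱 : Set (Set X)) (H : Set X → Kernel X X) (U : Set X) (f : X → ℝ) : Prop :=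
  ∃ h : X → ℝ, ContinuousOn h (closure U) ∧ EqOn h f (frontier U) ∧ Harmonic 𝒱 H U h

/-- Continuous superharmonic functions on `W`. -/
def ContinuousSuperharmonic (𝒱 : Set (Set X)) (H : Set X → Kernel X X) (W : Set X) (p : X → ℝ) :
    Prop :=
  ContinuousOn p W ∧ ∀ V ∈ inside 𝒱 W, ∀ x ∈ V, sweep H V p x ≤ p x

/-- The obstacle `φ = -p` is subharmonic: `φ ≤ H_V φ ≤ H_V R`. Hence its reduced function `R` is
harmonic in `U`, the barriers make it continuous up to `∂U` with values `-p`, and `-R` is the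
solution. -/
theorem ContinuousSuperharmonic.isSolvable {p : X → ℝ} (hp : ContinuousSuperharmonic 𝒱 H W p)
    (hN : IsNormalBauerFamily 𝒱 H) (hW : IsPSet 𝒱 H W) (hU : IsOpen U)
    (hUc : IsCompact (closure U)) (hUW : closure U ⊆ W) (hb : HasBarriers 𝒱 H U) :
    IsSolvable 𝒱 H U p := by
  obtain ⟨φ, hφ, hφp, M, hM⟩ := exists_bounded_continuous_extension (f := fun x => -p x) hUc
    (hp.1.mono hUW).neg
  have hUW' : U ⊆ W := subset_closure.trans hUW
  have hRc : ContinuousOn (reduced 𝒱 H U φ) U := continuousOn_reduced hN hW hU hUW' hφ hM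
  have hRh : Harmonic 𝒱 H U (reduced 𝒱 H U φ) := by
    refine ⟨hRc, fun V hV x hx => sweep_reduced_eq hN hW hU hUW' hφ hM hV (fun y hy => ?_) hx⟩
    have hVcl : closure V ⊆ closure U := hV.2.trans subset_closure
    calc φ y = -p y := hφp (hVcl (subset_closure hy))
      _ ≤ -sweep H V p y := neg_le_neg (hp.2 V (inside_mono hUW' hV) y hy)
      _ = sweep H V (fun x => -p x) y := (sweep_neg y p).symm
      _ = sweep H V φ y :=
        hN.sweep_congr hV.1 hy (hφp.mono (frontier_subset_closure.trans hVcl)).symm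
      _ ≤ sweep H V (reduced 𝒱 H U φ) y :=
        hN.sweep_mono hV.1 hy (hN.integrable hV.1 y hφ.measurable hM)
          (integrable_reduced hN hφ hM hV.1 y) fun t _ => le_reduced hN hM t
  refine ⟨fun x => -1 * reduced 𝒱 H U φ x, fun x hx => ?_, fun x hx => ?_, hRh.const_mul (-1)⟩
  · refine (ContinuousAt.mul continuousAt_const ?_).continuousWithinAt
    by_cases hxU : x ∈ U
    · exact hRc.continuousAt (hU.mem_nhds hxU)
    · obtain ⟨N, h, hNo, hzN, hh, hz, hpos⟩ := hb x (by rw [hU.frontier_eq]; exact ⟨hx, hxU⟩)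
      exact continuousAt_reduced_of_barrier hN hW hU hUW' hφ hM hxU hNo hzN hh hz hpos
  · have hxU : x ∉ U := by
      rw [hU.frontier_eq] at hx
      exact hx.2
    simp only [reduced_eq_of_notMem hN hM hxU, hφp (frontier_subset_closure hx)]
    ring

theorem IsSolvable.sub {f g : X → ℝ} (hf : IsSolvable 𝒱 H U f) (hg : IsSolvable 𝒱 H U g)
    (hN : IsNormalBauerFamily 𝒱 H) : IsSolvable 𝒱 H U fun x => f x - g x := by
  obtain ⟨h, hc, hb, hh⟩ := hf
  obtain ⟨k, kc, kb, hk⟩ := hg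
  exact ⟨fun x => h x - k x, hc.sub kc, fun x hx => by simp only [hb hx, kb hx], hh.sub hk hN⟩

namespace ContinuousSuperharmonic

variable {p q : X → ℝ}

theorem integrable (hp : ContinuousSuperharmonic 𝒱 H W p) (hN : IsNormalBauerFamily 𝒱 H)
    (hV : V ∈ inside 𝒱 W) {x : X} (hx : x ∈ V) : Integrable p (H V x) :=
  hN.integrable_of_continuousOn hV.1 hx (hp.1.mono (frontier_subset_closure.trans hV.2))

theorem const (hN : IsNormalBauerFamily 𝒱 H) (c : ℝ) :
    ContinuousSuperharmonic 𝒱 H W fun _ => c :=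
  ⟨continuousOn_const, fun _ hV x _ => (hN.sweep_const hV.1 c x).le⟩

theorem add (hp : ContinuousSuperharmonic 𝒱 H W p) (hq : ContinuousSuperharmonic 𝒱 H W q)
    (hN : IsNormalBauerFamily 𝒱 H) : ContinuousSuperharmonic 𝒱 H W fun x => p x + q x :=
  ⟨hp.1.add hq.1, fun V hV x hx =>
    (sweep_add (hp.integrable hN hV hx) (hq.integrable hN hV hx)).trans_le
      (add_le_add (hp.2 V hV x hx) (hq.2 V hV x hx))⟩

theorem const_mul (hp : ContinuousSuperharmonic 𝒱 H W p) {c : ℝ} (hc : 0 ≤ c) :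
    ContinuousSuperharmonic 𝒱 H W fun x => c * p x :=
  ⟨continuousOn_const.mul hp.1, fun V hV x hx =>
    (sweep_const_mul x c p).trans_le (mul_le_mul_of_nonneg_left (hp.2 V hV x hx) hc)⟩

theorem min (hp : ContinuousSuperharmonic 𝒱 H W p) (hq : ContinuousSuperharmonic 𝒱 H W q)
    (hN : IsNormalBauerFamily 𝒱 H) :
    ContinuousSuperharmonic 𝒱 H W fun x => Min.min (p x) (q x) :=
  ⟨ContinuousOn.inf hp.1 hq.1, fun V hV x hx => by
    have hi : Integrable (fun x => Min.min (p x) (q x)) (H V x) :=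
      (hp.integrable hN hV hx).inf (hq.integrable hN hV hx)
    exact le_min
      ((hN.sweep_mono hV.1 hx hi (hp.integrable hN hV hx) fun _ _ => min_le_left _ _).trans
        (hp.2 V hV x hx))
      ((hN.sweep_mono hV.1 hx hi (hq.integrable hN hV hx) fun _ _ => min_le_right _ _).trans
        (hq.2 V hV x hx))⟩

theorem exists_ne (hN : IsNormalBauerFamily 𝒱 H) (hW : IsPSet 𝒱 H W) {x y : X} (hx : x ∈ W)
    (hy : y ∈ W) (hxy : x ≠ y) : ∃ p, ContinuousSuperharmonic 𝒱 H W p ∧ p x ≠ p y := by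
  obtain ⟨w, hwl, hw, hne⟩ := hW.exists_ennreal hN hx hy hxy
  have main : ∀ a ∈ W, ∀ b ∈ W, w b < w a → ∃ p, ContinuousSuperharmonic 𝒱 H W p ∧ p a ≠ p b := by
    intro a ha b hb hab
    obtain ⟨t, φ, -, -, hφ, hφ0, hφt, -, -, -, h1, h2⟩ :=
      exists_reduced_lt hN hW.1 hwl hw ha hb hab Filter.univ_mem
    have hM : ∀ x, |φ x| ≤ t := fun x => by
      rw [abs_of_nonneg (hφ0 x)]
      exact hφt x
    exact ⟨reduced 𝒱 H W φ, ⟨continuousOn_reduced hN hW hW.1 subset_rfl hφ hM,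
      fun V hV x _ => sweep_reduced_le hN hφ hM hV x⟩, by rw [h1]; exact h2.ne'⟩
  rcases lt_or_gt_of_ne hne with h | h
  · obtain ⟨p, hp, hpne⟩ := main y hy x hx h
    exact ⟨p, hp, hpne.symm⟩
  · exact main x hx y hy h

end ContinuousSuperharmonic

/-- Differences of continuous superharmonic functions are dense in the continuous functions on a
compact subset of a `𝒫`-set. -/
theorem closure_differences_eq_top (hN : IsNormalBauerFamily 𝒱 H) (hW : IsPSet 𝒱 H W) {B : Set X}
    [CompactSpace B] (hBW : B ⊆ W) :
    closure {f : C(B, ℝ) | ∃ p q, ContinuousSuperharmonic 𝒱 H W p ∧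
      ContinuousSuperharmonic 𝒱 H W q ∧ ∀ x : B, f x = p x - q x} = ⊤ := by
  refine ContinuousMap.sublattice_closure_eq_top _
    ⟨0, fun _ => 0, fun _ => 0, .const hN 0, .const hN 0, by simp⟩ ?_ ?_ ?_
  · rintro f ⟨p, q, hp, hq, hf⟩ g ⟨r, t, hr, ht, hg⟩
    refine ⟨_, _, (hp.add ht hN).min (hr.add hq hN) hN, hq.add ht hN, fun x => ?_⟩
    rw [ContinuousMap.inf_apply, hf, hg, ← min_sub_sub_right]
    congr 1 <;> ring
  · rintro f ⟨p, q, hp, hq, hf⟩ g ⟨r, t, hr, ht, hg⟩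
    refine ⟨_, _, hp.add hr hN, (hp.add ht hN).min (hr.add hq hN) hN, fun x => ?_⟩
    rw [ContinuousMap.sup_apply, hf, hg, ← max_sub_sub_left, max_comm]
    congr 1 <;> ring
  · intro v x y
    by_cases hxy : x = y
    · subst hxy
      exact ⟨.const _ (v x), ⟨_, _, .const hN (v x), .const hN 0, by simp⟩, rfl, rfl⟩
    obtain ⟨p, hp, hpne⟩ := ContinuousSuperharmonic.exists_ne hN hW (hBW x.2) (hBW y.2)
      fun h => hxy (Subtype.ext h)
    -- The affine function `α p + const` of a separating `p` interpolates the two values. The sign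
    -- of `α` decides on which side of the difference `p` goes.
    set α := (v x - v y) / (p x - p y) with hα
    have hαp : α * (p x - p y) = v x - v y := div_mul_cancel₀ _ (sub_ne_zero.2 hpne)
    refine ⟨⟨fun t => α * p t + (v x - α * p x), by
      have := (hp.1.mono hBW).domRestrict
      exact (continuous_const.mul this).add continuous_const⟩, ?_, ?_, ?_⟩
    · rcases le_total 0 α with h | h
      · exact ⟨_, _, (hp.const_mul h).add (.const hN (v x - α * p x)) hN, .const hN 0,
          fun t => (sub_zero _).symm⟩
      · refine ⟨_, _, .const hN (v x - α * p x), hp.const_mul (neg_nonneg.2 h), fun t => ?_⟩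
        change α * p t + (v x - α * p x) = _
        ring
    · change α * p x + (v x - α * p x) = _
      ring
    · change α * p y + (v x - α * p x) = _
      linarith

/-- Solvability of the Dirichlet problem is preserved by uniform limits of boundary values. -/
theorem isSolvable_of_mem_closure (hN : IsNormalBauerFamily 𝒱 H) (hW : IsPSet 𝒱 H W)
    (hU : IsOpen U) (hUc : IsCompact (closure U)) (hUW : closure U ⊆ W)
    [CompactSpace (frontier U)] {L : Set C(frontier U, ℝ)}
    (hL : ∀ g ∈ L, ∃ F : X → ℝ, (∀ x : frontier U, F x = g x) ∧ IsSolvable 𝒱 H U F)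
    {f : C(frontier U, ℝ)} (hf : f ∈ closure L) {F : X → ℝ} (hF : ∀ x : frontier U, F x = f x) :
    IsSolvable 𝒱 H U F := by
  obtain ⟨g, hgL, hgf⟩ := mem_closure_iff_seq_limit.1 hf
  choose G hG h hc hb hh using fun n => hL (g n) (hgL n)
  -- The minimum principle for `dist (g m) (g n) - (h m - h n)`: solutions differ by no more than
  -- their boundary data.
  have hbound : ∀ m n, ∀ x ∈ closure U, h m x - h n x ≤ dist (g m) (g n) := by
    intro m n x hx
    have := (((harmonic_const hN (dist (g m) (g n))).sub ((hh m).sub (hh n) hN) hN)).nonneg hN hW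
      hUc hUW hU (continuousOn_const.sub ((hc m).sub (hc n))) (fun z hz => by
        have h1 := ContinuousMap.dist_apply_le_dist (f := g m) (g := g n) ⟨z, hz⟩
        rw [Real.dist_eq] at h1
        rw [hb m hz, hb n hz, hG m ⟨z, hz⟩, hG n ⟨z, hz⟩]
        linarith [le_abs_self (g m ⟨z, hz⟩ - g n ⟨z, hz⟩)]) x hx
    linarith
  have hcauchy : UniformCauchySeqOn h Filter.atTop (closure U) := by
    rw [Metric.uniformCauchySeqOn_iff]
    intro ε hε
    obtain ⟨n₀, hn₀⟩ := Metric.cauchySeq_iff.1 hgf.cauchySeq ε hε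
    refine ⟨n₀, fun m hm n hn x hx => lt_of_le_of_lt ?_ (hn₀ m hm n hn)⟩
    rw [Real.dist_eq, abs_le]
    have h1 := hbound m n x hx
    have h2 := hbound n m x hx
    rw [dist_comm] at h2
    constructor <;> linarith
  have hex : ∀ x, ∃ l, x ∈ closure U → Filter.Tendsto (fun n => h n x) Filter.atTop (𝓝 l) := by
    intro x
    by_cases hx : x ∈ closure U
    · obtain ⟨l, hl⟩ := cauchySeq_tendsto_of_complete (hcauchy.cauchySeq hx)
      exact ⟨l, fun _ => hl⟩
    · exact ⟨0, fun h => absurd h hx⟩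
  choose l hl using hex
  have hunif : TendstoUniformlyOn h l Filter.atTop (closure U) :=
    hcauchy.tendstoUniformlyOn_of_tendsto hl
  have hlc : ContinuousOn l (closure U) := hunif.continuousOn (.of_forall hc)
  refine ⟨l, hlc, fun x hx => ?_, hlc.mono subset_closure, fun V hV x hx => ?_⟩
  · refine tendsto_nhds_unique (hl x (frontier_subset_closure hx)) ?_
    rw [hF ⟨x, hx⟩]
    have h1 : Filter.Tendsto (fun n => g n ⟨x, hx⟩) Filter.atTop (𝓝 (f ⟨x, hx⟩)) :=
      ((continuous_eval_const (⟨x, hx⟩ : frontier U)).tendsto f).comp hgf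
    refine h1.congr fun n => ?_
    rw [hb n hx, hG n ⟨x, hx⟩]
  · have hVU : frontier V ⊆ closure U :=
      frontier_subset_closure.trans (hV.2.trans subset_closure)
    have hxU : x ∈ closure U := subset_closure (hV.2 (subset_closure hx))
    refine tendsto_nhds_unique ?_ (hl x hxU)
    rw [Metric.tendsto_atTop]
    intro ε hε
    obtain ⟨n₀, hn₀⟩ := Filter.eventually_atTop.1
      (Metric.tendstoUniformlyOn_iff.1 hunif (ε / 2) (half_pos hε))
    refine ⟨n₀, fun n hn => ?_⟩
    have hp := hN.isProbabilityMeasure hV.1 x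
    have hil : Integrable l (H V x) := hN.integrable_of_continuousOn hV.1 hx (hlc.mono hVU)
    have hin := (hh n).integrable hN hV hx
    have h1 : ‖∫ y, (h n y - l y) ∂(H V x)‖ ≤ ε / 2 := by
      have := norm_integral_le_of_norm_le_const (μ := H V x) (f := fun y => h n y - l y)
        (C := ε / 2) (by
          filter_upwards [hN.ae_mem_frontier hV.1 hx] with y hy
          have := hn₀ n hn y (hVU hy)
          rw [dist_comm, Real.dist_eq] at this
          exact this.le)
      simpa using this
    rw [integral_sub hin hil] at h1
    have h2 : ∫ y, h n y ∂(H V x) = h n x := (hh n).2 V hV x hx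
    rw [h2] at h1
    rw [Real.dist_eq]
    exact lt_of_le_of_lt h1 (half_lt_self hε)

/-- Existence combines solvability for superharmonic data with density of their differences.
Uniqueness and positivity are instances of the minimum principle. -/
theorem isRegular_of_hasBarriers (hN : IsNormalBauerFamily 𝒱 H) (hW : IsPSet 𝒱 H W)
    (hU : IsOpen U) (hUc : IsCompact (closure U)) (hUW : closure U ⊆ W)
    (hb : HasBarriers 𝒱 H U) : IsRegular 𝒱 H U := by
  have hfc : IsCompact (frontier U) := hUc.of_isClosed_subset isClosed_frontier
    frontier_subset_closure
  have hfc' : CompactSpace (frontier U) := isCompact_iff_compactSpace.1 hfc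
  refine ⟨hU, hUc, fun f hf => ?_⟩
  obtain ⟨h, hc, hbd, hh⟩ : IsSolvable 𝒱 H U f := by
    refine isSolvable_of_mem_closure hN hW hU hUc hUW
      (L := {f : C(frontier U, ℝ) | ∃ p q, ContinuousSuperharmonic 𝒱 H W p ∧
        ContinuousSuperharmonic 𝒱 H W q ∧ ∀ x : frontier U, f x = p x - q x}) ?_
      (f := ⟨(frontier U).domRestrict f, hf.domRestrict⟩) ?_ (fun _ => rfl)
    · rintro g ⟨p, q, hp, hq, hg⟩
      exact ⟨fun x => p x - q x, fun x => (hg x).symm,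
        (hp.isSolvable hN hW hU hUc hUW hb).sub (hq.isSolvable hN hW hU hUc hUW hb) hN⟩
    · rw [closure_differences_eq_top hN hW (frontier_subset_closure.trans hUW)]
      trivial
  refine ⟨h, ⟨hc, hbd, hh⟩, fun k kc kb hk x hx => ?_, fun h0 => ?_⟩
  · have h1 := (hh.sub hk hN).nonneg hN hW hUc hUW hU (hc.sub kc)
      (fun z hz => by rw [hbd hz, kb hz, sub_self]) x hx
    have h2 := (hk.sub hh hN).nonneg hN hW hUc hUW hU (kc.sub hc)
      (fun z hz => by rw [hbd hz, kb hz, sub_self]) x hx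
    linarith
  · exact hh.nonneg hN hW hUc hUW hU hc fun z hz => by rw [hbd hz]; exact h0 z hz

end Bauer

end

theorem corollary5p3 {X : Type*} [TopologicalSpace X] [T2Space X] [LocallyCompactSpace X]
    [SecondCountableTopology X] [MeasurableSpace X] [BorelSpace X]
    (𝒱 : Set (Set X)) (H : Set X → ProbabilityTheory.Kernel X X)
    (hH : Bauer.IsNormalBauerFamily 𝒱 H) (hell : Bauer.IsElliptic 𝒱 H)
    (W : Set X) (hW : Bauer.IsPSet 𝒱 H W) (K : Set X) (hK : IsCompact K) (hKW : K ⊆ W) :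
    ∃ U : Set X, Bauer.IsRegular 𝒱 H U ∧ K ⊆ U ∧ closure U ⊆ W := by
  obtain ⟨U, hU, hUc, hKU, hUW, hb⟩ := Bauer.exists_isOpen_hasBarriers hH hell hW hK hKW
  exact ⟨U, Bauer.isRegular_of_hasBarriers hH hW hU hUc hUW hb, hKU, hUW⟩
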